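/- Let $\mathcal S,\mathcal A$ be finite state and action spaces, $d=|\mathcal S||\mathcal A|$, and consider a fixed-horizon MDP with horizon $h$, initial distribution $p_0$, true transition dynamics $\overline p=(\overline p(s'\mid s,a))_{s,a,s'}$, and preference feedback: trajectories are $\tau=(s_1,a_1,\dots,s_h,a_h,s_{h+1})$ with visit-count vector $x(\tau)\in\mathbb R^{d}$, and there is a utility vector $\overline r\in\mathbb R^{d}$ with $P(\tau'\succ\tau)=\overline r^{\top}(x(\tau')-x(\tau))+\tfrac12$ for all trajectories $\tau,\tau'$. Fix Dirichlet prior parameters $\alpha_{s,a,s'}>0$, $\lambda\ge 1$, $R>0$, $S_r\ge\|\overline r\|_2$ and $\delta\in(0,1)$. Dueling Posterior Sampling (DPS) runs as follows. In iteration $i=1,2,\dots$, given the history $\mathcal H_{i-1}=(\tau_{k1},\tau_{k2},y_k)_{k<i}$, put $x_k=x(\tau_{k2})-x(\tau_{k1})$, $M_i=\lambda I+\sum_{k<i}x_kx_k^{\top}$, $\hat r_i=M_i^{-1}\sum_{k<i}y_kx_k$ and $\beta_i=R\sqrt{2\log\big(\det(M_i)^{1/2}\lambda^{-d/2}/\delta\big)}+\sqrt\lambda\,S_r$.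 For $j\in\{1,2\}$, conditionally independently given $\mathcal H_{i-1}$: - sample dynamics $\tilde p_{ij}$, where, independently over $(s,a)$, $\tilde p_{ij}(\cdot\mid s,a)$ is Dirichlet with parameters $\alpha_{s,a,s'}$ plus the number of transitions $(s,a)\to s'$ in $\mathcal H_{i-1}$; - sample rewards $\tilde r_{ij}\sim\mathcal N(\hat r_i,\beta_i^2M_i^{-1})$, independently of $\tilde p_{ij}$. Then let $\pi_{ij}$ be a deterministic time-dependent policy maximizing the expected total reward of a length-$h$ episode (with initial distribution $p_0$) under dynamics $\tilde p_{ij}$ and rewards $\tilde r_{ij}$, ties being broken in any, possibly random, way. Roll out $\pi_{i1},\pi_{i2}$ independently in the true MDP to get $\tau_{i1},\tau_{i2}$, and observe $y_i=\mathbb 1[\tau_{i2}\succ\tau_{i1}]-\tfrac12$. Call a state reachable if some policy visits it with positive probability at one of the time steps $1,\dots,h$. Then, for each $j\in\{1,2\}$, as $i\to\infty$, the sampled dynamics at the state-action pairs with reachable state converge in distribution to the true ones: $$\big(\tilde p_{ij}(s'\mid s,a)\big)_{s\text{ reachable},\,a,\,s'}\ \overset{D}{\longrightarrow}\ \big(\overline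 p(s'\mid s,a)\big)_{s\text{ reachable},\,a,\,s'}.$$ In particular, if every state is reachable, then $\tilde p_{i1}\overset{D}{\longrightarrow}\overline p$ and $\tilde p_{i2}\overset{D}{\longrightarrow}\overline p$. -/

import Mathlib

open MeasureTheory ProbabilityTheory Filter

noncomputable section

namespace DPS

/-! ### Fixed-horizon preference MDPs -/

/-- Deterministic, time-dependent policies for episodes of length `h`. -/
abbrev Policy (S A : Type*) (h : ℕ) := S → Fin h → A

/-- Trajectories `s₁, a₁, …, s_h, a_h, s_{h+1}`: the states (indexed from `0` to `h`) and
the actions (indexed from `0` to `h - 1`). -/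
abbrev Traj (S A : Type*) (h : ℕ) := (Fin (h + 1) → S) × (Fin h → A)

/-- A fixed-horizon Markov decision process `(S, A, φ, p, p₀, h)` with preference feedback:
`pref τ τ'` is the probability `φ(τ, τ')` that `τ` is preferred to `τ'`. -/
structure PrefMDP (S A : Type*) (h : ℕ) where
  /-- initial state distribution -/
  p₀ : PMF S
  /-- transition dynamics -/
  p : S → A → PMF S
  /-- preference probabilities -/
  pref : Traj S A h → Traj S A h → unitInterval

/-- The weight `p₀(s₁) ∏ₜ p(sₜ₊₁ ∣ sₜ, π(sₜ, t))` of a state sequence. -/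
def pathWeight {S A : Type*} {h : ℕ} {K : Type*} [CommSemiring K] (p₀ : S → K)
    (p : S → A → S → K) (π : Policy S A h) (σ : Fin (h + 1) → S) : K :=
  p₀ (σ 0) * ∏ t : Fin h, p (σ t.castSucc) (π (σ t.castSucc) t) (σ t.succ)

/-- The number of times a trajectory visits each state-action pair, as a vector. -/
def visits {S A : Type*} [DecidableEq S] [DecidableEq A] {h : ℕ} (τ : Traj S A h) :
    EuclideanSpace ℝ (S × A) :=
  WithLp.toLp 2 fun q => ∑ t : Fin h, if (τ.1 t.castSucc, τ.2 t) = q then 1 else 0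

/-- The number of transitions from `(s, a)` to `s'` in a trajectory. -/
def transitions {S A : Type*} [DecidableEq S] [DecidableEq A] {h : ℕ} (τ : Traj S A h)
    (s : S) (a : A) (s' : S) : ℕ :=
  ∑ t : Fin h, if τ.1 t.castSucc = s ∧ τ.2 t = a ∧ τ.1 t.succ = s' then 1 else 0

/-- The value `V(p, r, π)`: the expected total reward of an episode under initial distribution
`p₀`, dynamics `p`, rewards `r` and policy `π`. -/
def value {S A : Type*} [Fintype S] {h : ℕ} (p₀ : S → ℝ) (p : S → A → S → ℝ)
    (r : EuclideanSpace ℝ (S × A)) (π : Policy S A h) : ℝ :=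
  ∑ σ : Fin (h + 1) → S,
    pathWeight p₀ p π σ * ∑ t : Fin h, r (σ t.castSucc, π (σ t.castSucc) t)

/-- `π` attains `max_π V(p, r, π)` over all deterministic policies. -/
def IsOptimalPolicy {S A : Type*} [Fintype S] {h : ℕ} (p₀ : S → ℝ) (p : S → A → S → ℝ)
    (r : EuclideanSpace ℝ (S × A)) (π : Policy S A h) : Prop :=
  ∀ π' : Policy S A h, value p₀ p r π' ≤ value p₀ p r π

/-- Weights of the paths of a (time-inhomogeneous) Markov chain sum to one. -/
theorem sum_chain_eq_one {S : Type*} [Fintype S] :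
    ∀ (h : ℕ) (q : PMF S) (k : Fin h → S → PMF S),
      ∑ σ : Fin (h + 1) → S, q (σ 0) * ∏ t : Fin h, k t (σ t.castSucc) (σ t.succ) = 1 := by
  intro h
  induction h with
  | zero =>
    intro q k
    rw [← (Equiv.funUnique (Fin 1) S).symm.sum_comp]
    simpa [tsum_fintype] using q.tsum_coe
  | succ n ih =>
    intro q k
    rw [← (Fin.consEquiv (fun _ : Fin (n + 2) => S)).sum_comp, Fintype.sum_prod_type]
    have hq : ∑ s, q s = 1 := by simpa [tsum_fintype] using q.tsum_coe
    refine Eq.trans (Finset.sum_congr rfl fun s _ => ?_) hq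
    have hs := ih (k 0 s) (fun t => k t.succ)
    calc _ = ∑ σ : Fin (n + 1) → S, q s *
          (k 0 s (σ 0) * ∏ t : Fin n, k t.succ (σ t.castSucc) (σ t.succ)) := by
          refine Finset.sum_congr rfl fun σ _ => ?_
          simp [Fin.consEquiv, Fin.prod_univ_succ]
      _ = q s := by rw [← Finset.mul_sum, hs, mul_one]

namespace PrefMDP

variable {S A : Type*} {h : ℕ}

/-- The vector of all true transition probabilities `p(s' ∣ s, a)`. -/
def dyn (M : PrefMDP S A h) : S → A → S → ℝ := fun s a s' => (M.p s a s').toReal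

/-- The initial distribution as a real-valued function. -/
def init (M : PrefMDP S A h) : S → ℝ := fun s => (M.p₀ s).toReal

/-- The law of the trajectory obtained by rolling out the policy `π` in the MDP. -/
def rollout [Fintype S] (M : PrefMDP S A h) (π : Policy S A h) : PMF (Traj S A h) :=
  (PMF.ofFintype (pathWeight (fun s => M.p₀ s) (fun s a s' => M.p s a s') π)
    (sum_chain_eq_one h M.p₀ fun t s => M.p s (π s t))).map
      fun σ => (σ, fun t => π (σ t.castSucc) t)

/-- Some policy visits the state `s` with positive probability at one of the time steps
`1, …, h` at which an action is taken. -/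
def Reachable [Fintype S] (M : PrefMDP S A h) (s : S) : Prop :=
  ∃ (π : Policy S A h) (τ : Traj S A h) (t : Fin h), M.rollout π τ ≠ 0 ∧ τ.1 t.castSucc = s

/-- Preferences follow the linear link function with utility vector `rbar`:
`P(τ' ≻ τ) = rbar ⬝ (x(τ') - x(τ)) + 1/2`. -/
def HasLinearLink [Fintype S] [Fintype A] [DecidableEq S] [DecidableEq A] (M : PrefMDP S A h)
    (rbar : EuclideanSpace ℝ (S × A)) : Prop :=
  ∀ τ τ' : Traj S A h, (M.pref τ' τ : ℝ) = inner ℝ rbar (visits τ' - visits τ) + 1 / 2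

end PrefMDP

/-! ### The posteriors -/

/-- The Dirichlet distribution with parameters `α k > 0`: the law of `G k / ∑ l, G l` for
independent Gamma variables `G k` of shape `α k` and rate `1`. -/
def dirichlet {ι : Type*} [Fintype ι] (α : ι → ℝ) : Measure (ι → ℝ) :=
  (Measure.pi fun k => gammaMeasure (α k) 1).map fun g k => g k / ∑ l, g l

/-- Hyperparameters of the algorithm: the Dirichlet prior, the ridge parameter `λ`, the
sub-Gaussian constant `R`, the bound `S_r` on the utilities and the failure probability `δ`. -/
structure Hyper (S A : Type*) where
  α : S → A → S → ℝ
  lam : ℝ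
  R : ℝ
  Sr : ℝ
  δ : ℝ

/-- The history of `n` iterations: for each of them the two trajectories `τ₁` (index `0`) and
`τ₂` (index `1`), and whether `τ₂` was preferred to `τ₁`. -/
abbrev History (S A : Type*) (h n : ℕ) := Fin n → (Fin 2 → Traj S A h) × Bool

section Posterior

variable {S A : Type*} [Fintype S] [Fintype A] [DecidableEq S] [DecidableEq A] {h n : ℕ}

/-- The observation `xₖ = xₖ₂ - xₖ₁`. -/
def obs (H : History S A h n) (k : Fin n) : EuclideanSpace ℝ (S × A) :=
  visits ((H k).1 1) - visits ((H k).1 0)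

/-- The label `yₖ = 𝟙[τₖ₂ ≻ τₖ₁] - 1/2`. -/
def lab (H : History S A h n) (k : Fin n) : ℝ := (if (H k).2 = true then 1 else 0) - 1 / 2

/-- The matrix `λ I + ∑ₖ xₖ xₖᵀ`. -/
def designMatrix (θ : Hyper S A) (H : History S A h n) : Matrix (S × A) (S × A) ℝ :=
  θ.lam • (1 : Matrix (S × A) (S × A) ℝ) +
    ∑ k, Matrix.vecMulVec (fun q => obs H k q) (fun q => obs H k q)

/-- The ridge regression (MAP) estimate of the utilities. -/
def rewardMAP (θ : Hyper S A) (H : History S A h n) : EuclideanSpace ℝ (S × A) :=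
  WithLp.toLp 2 (Matrix.mulVec (designMatrix θ H)⁻¹ fun q => ∑ k, lab H k * obs H k q)

/-- The factor `β(δ) = R √(2 log (det(M)^{1/2} λ^{-d/2} / δ)) + √λ S_r`, where `d = |S| |A|`. -/
def beta (θ : Hyper S A) (H : History S A h n) : ℝ :=
  θ.R * Real.sqrt (2 * Real.log ((designMatrix θ H).det ^ (1 / 2 : ℝ) *
    θ.lam ^ (-(Fintype.card (S × A) : ℝ) / 2) / θ.δ)) + Real.sqrt θ.lam * θ.Sr

/-- The reward posterior `N(r̂, β² M⁻¹)`. -/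
def rewardPosterior (θ : Hyper S A) (H : History S A h n) :
    Measure (EuclideanSpace ℝ (S × A)) :=
  multivariateGaussian (rewardMAP θ H) (beta θ H ^ 2 • (designMatrix θ H)⁻¹)

/-- The dynamics posterior: independently for each state-action pair, a Dirichlet distribution
whose parameters are the prior parameters plus the numbers of observed transitions. -/
def dynPosterior (θ : Hyper S A) (H : History S A h n) : Measure (S → A → S → ℝ) :=
  Measure.pi fun s => Measure.pi fun a => dirichlet fun s' =>
    θ.α s a s' + ∑ k, ∑ j, (transitions ((H k).1 j) s a s' : ℝ)

end Posterior

/-! ### The algorithm -/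

section Algorithm

variable {S A : Type*} [Fintype S] [Fintype A] [DecidableEq S] [DecidableEq A]
  [MeasurableSpace S] [MeasurableSpace A] [MeasurableSingletonClass S]
  [MeasurableSingletonClass A] {h : ℕ}

/-- The values of a pair `(p̃₁, r̃₁), (p̃₂, r̃₂)` of posterior samples. -/
abbrev Samples (S A : Type*) := Fin 2 → (S → A → S → ℝ) × EuclideanSpace ℝ (S × A)

/-- Given the history, the two samples of dynamics and rewards are independent draws from the
posteriors. -/
def sampleKernel (θ : Hyper S A) (n : ℕ) : Kernel (History S A h n) (Samples S A) :=
  Kernel.ofFunOfCountable fun H => Measure.pi fun _ =>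
    (dynPosterior θ H).prod (rewardPosterior θ H)

/-- Given the history, the samples and the two policies, the two policies are rolled out
independently in the true MDP. -/
def rolloutKernel (M : PrefMDP S A h) (n : ℕ) :
    Kernel (History S A h n × Samples S A × (Fin 2 → Policy S A h)) (Fin 2 → Traj S A h) :=
  (Kernel.ofFunOfCountable fun π : Fin 2 → Policy S A h =>
    Measure.pi fun j => (M.rollout (π j)).toMeasure).comap (fun z => z.2.2) (by fun_prop)

/-- Given the history, the samples, the policies and the two trajectories, `τ₂` is preferred
to `τ₁` with probability `φ(τ₂, τ₁)`. -/
def prefKernel (M : PrefMDP S A h) (n : ℕ) :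
    Kernel ((History S A h n × Samples S A × (Fin 2 → Policy S A h)) × (Fin 2 → Traj S A h))
      Bool :=
  (Kernel.ofFunOfCountable fun τ : Fin 2 → Traj S A h =>
    bernoulliMeasure true false (M.pref (τ 1) (τ 0))).comap (fun z => z.2) (by fun_prop)

/-- The random variables `samp`, `pol`, `traj`, `label` on the probability space `(Ω, P)` are a
run of Dueling Posterior Sampling in the MDP `M` with hyperparameters `θ`. Iterations are indexed
from `0`; iteration `i` follows the history of iterations `0, …, i - 1`. The index `j : Fin 2`
distinguishes the two samples, policies and trajectories of an iteration. Ties between optimal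
policies may be broken in any (possibly randomized) way. -/
structure IsDPS (M : PrefMDP S A h) (θ : Hyper S A) {Ω : Type*} [MeasurableSpace Ω]
    (P : Measure Ω) (samp : ℕ → Ω → Samples S A) (pol : ℕ → Ω → Fin 2 → Policy S A h)
    (traj : ℕ → Ω → Fin 2 → Traj S A h) (label : ℕ → Ω → Bool) : Prop where
  /-- dynamics and rewards are sampled from the posteriors given the history -/
  samp_law : ∀ i, HasCondDistrib (samp i) (fun ω (k : Fin i) => (traj k ω, label k ω))
    (sampleKernel θ i) P
  /-- the policies are optimal for the sampled dynamics and rewards -/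
  pol_opt : ∀ i, ∀ᵐ ω ∂P, ∀ j,
    IsOptimalPolicy M.init (samp i ω j).1 (samp i ω j).2 (pol i ω j)
  /-- the policies are rolled out in the true MDP -/
  traj_law : ∀ i, HasCondDistrib (traj i)
    (fun ω => ((fun (k : Fin i) => (traj k ω, label k ω)), samp i ω, pol i ω))
    (rolloutKernel M i) P
  /-- a preference between the two trajectories is observed -/
  label_law : ∀ i, HasCondDistrib (label i)
    (fun ω => (((fun (k : Fin i) => (traj k ω, label k ω)), samp i ω, pol i ω), traj i ω))
    (prefKernel M i) P

end Algorithm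

end DPS

end

/-!
Convergence in probability to the true dynamics follows once every pair `(s, a)` with a reachable
state `s` is almost surely visited infinitely often: the transition frequencies at such a pair
converge by a strong law of large numbers (`IsDPS.ae_tendsto_transCount_div`, from an `L²`-bounded
martingale and Kronecker's lemma), and a Dirichlet posterior concentrates at the limit of the
frequencies (`tendsto_dirichlet_real_ge`, by Chebyshev's inequality for the underlying Gamma
variables). The conditional laws are then integrated with dominated convergence.

The visits are the heart of the matter (`IsDPS.ae_tendsto_visitCount`). Let `U` be the random set of
pairs that are visited infinitely often, and suppose that it misses a pair with a reachable state.
Some policy then leaves `U` with positive probability in the true MDP. Three facts hold eventually.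

* The dynamics posterior is concentrated near the truth at the pairs in `U`. The probability that a
  policy leaves `U` depends only on the dynamics at the pairs in `U`, so it is nearly the same for
  the sampled as for the true dynamics.
* With `u` the indicator of the complement of `U`, the form `uᵀ M u` stays bounded, since the
  observations vanish outside `U` from some time on. The Gaussian reward posterior with covariance
  `β² M⁻¹` therefore shifts the rewards by about `t β u`, for any fixed `t`, with a probability that
  is bounded below (`exists_le_rewardPosterior`).
* The mean of this posterior is at most a random constant times `β`
  (`IsDPS.ae_norm_rewardMAP_le`). With `s` the residual of the ridge regression, the process
  `exp ((sᵀ M⁻¹ s - log det M) / 4)` is a nonnegative supermartingale, by a rank-one update of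
  `sᵀ M⁻¹ s` and sub-Gaussianity of the labels, so `sᵀ M⁻¹ s` exceeds `log det M` by a bounded
  amount only, and `β²` grows at least like a multiple of `log det M`.

For `t` large, an optimal policy for such samples is compelled to leave `U`, also in the true MDP,
with a probability that is bounded below (`exists_explore`). By a conditional Borel-Cantelli lemma
(`ae_not_eventually_of_cond_lower_bound`), `U` is left infinitely often, which contradicts its
definition. As `U` takes finitely many values and the random constants can be taken to be integers,
only countably many null sets are involved.
-/

set_option linter.unusedSectionVars false

noncomputable section

namespace DPS

open scoped Topology ENNReal

/-! ### Finite-valued processes: martingale convergence and Borel-Cantelli -/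

/-- The first `n` terms of a sequence. -/
def hist {X : Type*} (z : ℕ → X) (n : ℕ) : Fin n → X := fun k => z k

lemma aemeasurable_hist {X Ω : Type*} [MeasurableSpace X] [MeasurableSpace Ω] {P : Measure Ω}
    {z : Ω → ℕ → X} (hz : ∀ k, AEMeasurable (fun ω => z ω k) P) (n : ℕ) :
    AEMeasurable (fun ω => hist (z ω) n) P :=
  aemeasurable_pi_lambda _ fun k => hz k

section Histories

variable {X Ω : Type*} [Finite X] [MeasurableSpace X] [MeasurableSingletonClass X]
  [MeasurableSpace Ω] {P : Measure Ω} [IsProbabilityMeasure P]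

lemma integrable_of_finite_range {Y : Type*} [Finite Y] [MeasurableSpace Y]
    [MeasurableSingletonClass Y] {Z : Ω → Y} (hZ : AEMeasurable Z P) (f : Y → ℝ) :
    Integrable (fun ω => f (Z ω)) P := by
  obtain ⟨C, hC⟩ := (Set.finite_range fun y => |f y|).bddAbove
  exact Integrable.of_bound ((measurable_of_countable f).comp_aemeasurable hZ).aestronglyMeasurable
    C (ae_of_all _ fun ω => hC ⟨Z ω, rfl⟩)

/-- Martingale convergence for functions of the history of a finite-valued process: it suffices to
test the submartingale property against nonnegative functions of the history. -/
theorem ae_exists_tendsto_hist {z : Ω → ℕ → X} (hz : ∀ k, AEMeasurable (fun ω => z ω k) P)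
    (f : ∀ n, (Fin n → X) → ℝ)
    (hf : ∀ n (g : (Fin n → X) → ℝ), (∀ H, 0 ≤ g H) →
      0 ≤ ∫ ω, g (hist (z ω) n) * (f (n + 1) (hist (z ω) (n + 1)) - f n (hist (z ω) n)) ∂P)
    (C : ℝ) (hC : ∀ n, ∫ ω, |f n (hist (z ω) n)| ∂P ≤ C) :
    ∀ᵐ ω ∂P, ∃ c, Tendsto (fun n => f n (hist (z ω) n)) atTop (𝓝 c) := by
  -- pass to a version of the process that is measurable, not only a.e.-measurable
  let z' : Ω → ℕ → X := fun ω k => (hz k).mk _ ω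
  have hz' : ∀ k, Measurable fun ω => z' ω k := fun k => (hz k).measurable_mk
  have hzz : ∀ᵐ ω ∂P, z ω = z' ω := by
    filter_upwards [ae_all_iff.2 fun k => (hz k).ae_eq_mk] with ω h
    exact funext h
  have hm : ∀ n, Measurable fun ω => hist (z' ω) n :=
    fun n => measurable_pi_lambda _ fun k => hz' k
  let 𝒢 : Filtration ℕ (inferInstance : MeasurableSpace Ω) :=
    { seq := fun n => MeasurableSpace.comap (fun ω => hist (z' ω) n) inferInstance
      mono' := by
        intro m n hmn
        have : (fun ω => hist (z' ω) m) =
            (fun H : Fin n → X => fun k : Fin m => H (Fin.castLE hmn k)) ∘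
              fun ω => hist (z' ω) n := rfl
        change MeasurableSpace.comap (fun ω => hist (z' ω) m) inferInstance ≤ _
        rw [this, ← MeasurableSpace.comap_comp]
        exact MeasurableSpace.comap_mono (measurable_of_countable _).comap_le
      le' := fun n => (hm n).comap_le }
  have hint : ∀ n, Integrable (fun ω => f n (hist (z' ω) n)) P :=
    fun n => integrable_of_finite_range (hm n).aemeasurable _
  have hsub : Submartingale (fun n ω => f n (hist (z' ω) n)) 𝒢 P := by
    refine submartingale_of_setIntegral_le_succ (fun n => ?_) hint fun n s hs => ?_
    · exact ((measurable_of_countable (f n)).comp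
        (comap_measurable (fun ω => hist (z' ω) n))).stronglyMeasurable
    · obtain ⟨B, hB, rfl⟩ := hs
      have h1 := hf n (B.indicator 1) fun H => Set.indicator_nonneg (by simp) _
      have hmB := hm n hB
      rw [← sub_nonneg, ← integral_sub (hint _).integrableOn (hint _).integrableOn,
        ← integral_indicator hmB]
      refine h1.trans_eq (integral_congr_ae ?_)
      filter_upwards [hzz] with ω hω
      rw [hω]
      by_cases h : hist (z' ω) n ∈ B <;> simp [Set.indicator, h]
  have key := hsub.exists_ae_tendsto_of_bdd (R := C.toNNReal) fun n => by
    rw [eLpNorm_one_eq_lintegral_enorm, ← ofReal_integral_norm_eq_lintegral_enorm (hint n)]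
    refine ENNReal.ofReal_le_ofReal (le_trans (le_of_eq (integral_congr_ae ?_)) (hC n))
    filter_upwards [hzz] with ω hω
    rw [hω, Real.norm_eq_abs]
  filter_upwards [key, hzz] with ω h1 h2
  rwa [h2]

/-- A conditional Borel-Cantelli lemma: if, given any history in `A n`, the next term falls
into `B` with probability at least `c > 0`, then almost surely it is impossible that the history
eventually stays in `A` while the process eventually avoids `B`. -/
theorem ae_not_eventually_of_cond_lower_bound {z : Ω → ℕ → X}
    (hz : ∀ k, AEMeasurable (fun ω => z ω k) P) (A : ∀ n, Set (Fin n → X)) (B : Set X)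
    {c : ℝ} (hc : 0 < c)
    (h : ∀ n (D : Set (Fin n → X)), D ⊆ A n →
      c * P.real {ω | hist (z ω) n ∈ D} ≤ P.real {ω | hist (z ω) n ∈ D ∧ z ω n ∈ B}) :
    ∀ᵐ ω ∂P, ¬ ∀ᶠ n in atTop, hist (z ω) n ∈ A n ∧ z ω n ∉ B := by
  have hnullB : ∀ n, NullMeasurableSet {ω | z ω n ∈ B} P :=
    fun n => (hz n).nullMeasurable B.toFinite.measurableSet
  have hone : ∀ n (D : Set (Fin n → X)), D ⊆ A n →
      P.real {ω | hist (z ω) n ∈ D ∧ z ω n ∉ B} ≤ (1 - c) * P.real {ω | hist (z ω) n ∈ D} := by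
    intro n D hD
    have h1 := measureReal_inter_add_sdiff₀ (μ := P) (s := {ω | hist (z ω) n ∈ D}) (hnullB n)
    have h2 := h n D hD
    simp only [Set.inter_def, Set.sdiff_eq, Set.compl_def, Set.mem_ofPred_eq] at h1
    linarith
  -- `D m n` is the set of histories that stay in `A` and avoid `B` from time `m` on
  let D : ℕ → ∀ n, Set (Fin n → X) := fun m n =>
    {H | ∀ i : Fin n, m ≤ i → (fun k : Fin i => H (Fin.castLE i.2.le k)) ∈ A i ∧ H i ∉ B}
  have hDz : ∀ m n ω, hist (z ω) n ∈ D m n ↔ ∀ i < n, m ≤ i → hist (z ω) i ∈ A i ∧ z ω i ∉ B :=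
    fun m n ω => ⟨fun hh i hi hmi => hh ⟨i, hi⟩ hmi, fun hh i hmi => hh i i.2 hmi⟩
  have hc1 : 0 ≤ max (1 - c) 0 := le_max_right _ _
  have hdecay : ∀ m k, P.real {ω | hist (z ω) (m + k) ∈ D m (m + k) ∩ A (m + k)} ≤
      max (1 - c) 0 ^ k := by
    intro m k
    induction k with
    | zero => simp
    | succ k ih =>
      refine le_trans (measureReal_mono (s₂ := {ω | hist (z ω) (m + k) ∈ D m (m + k) ∩ A (m + k)
        ∧ z ω (m + k) ∉ B}) ?_) ((hone _ _ Set.inter_subset_right).trans ?_)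
      · rintro ω ⟨h1, -⟩
        rw [← add_assoc, hDz] at h1
        have h2 := h1 (m + k) (by omega) (by omega)
        exact ⟨⟨(hDz m _ ω).2 fun i hi hmi => h1 i (by omega) hmi, h2.1⟩, h2.2⟩
      · rw [pow_succ']
        exact mul_le_mul (le_max_left _ _) ih measureReal_nonneg hc1
  have hzero : ∀ m, P {ω | ∀ i, m ≤ i → hist (z ω) i ∈ A i ∧ z ω i ∉ B} = 0 := by
    intro m
    rw [← measureReal_eq_zero_iff]
    refine le_antisymm (ge_of_tendsto' (tendsto_pow_atTop_nhds_zero_of_lt_one hc1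
      (max_lt (by linarith) one_pos)) fun k => le_trans (measureReal_mono ?_) (hdecay m k))
      measureReal_nonneg
    intro ω hω
    exact ⟨(hDz m _ ω).2 fun i _ hmi => hω i hmi, (hω (m + k) (by omega)).1⟩
  have hall : ∀ᵐ ω ∂P, ∀ m, ¬ ∀ i, m ≤ i → hist (z ω) i ∈ A i ∧ z ω i ∉ B :=
    ae_all_iff.2 fun m => by simpa [ae_iff] using hzero m
  filter_upwards [hall] with ω hω hev
  obtain ⟨m, hm⟩ := eventually_atTop.1 hev
  exact hω m hm

end Histories

/-- Disintegration of expectations of bounded functions along a conditional distribution. -/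
theorem integral_of_hasCondDistrib {Ω 𝓧 𝓨 : Type*} [MeasurableSpace Ω] [MeasurableSpace 𝓧]
    [MeasurableSpace 𝓨] {P : Measure Ω} [IsProbabilityMeasure P] {X : Ω → 𝓧} {Y : Ω → 𝓨}
    {κ : Kernel 𝓧 𝓨} [IsMarkovKernel κ] (h : HasCondDistrib Y X κ P) {F : 𝓧 → 𝓨 → ℝ}
    (hF : Measurable (Function.uncurry F)) (C : ℝ) (hC : ∀ x y, |F x y| ≤ C) :
    ∫ ω, F (X ω) (Y ω) ∂P = ∫ ω, ∫ y, F (X ω) y ∂κ (X ω) ∂P := by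
  have hX := h.aemeasurable_fst
  have : IsProbabilityMeasure (P.map X) := Measure.isProbabilityMeasure_map hX
  have hbd : Integrable (Function.uncurry F) ((P.map X) ⊗ₘ κ) :=
    Integrable.of_bound hF.aestronglyMeasurable C (ae_of_all _ fun p => hC p.1 p.2)
  have h1 : ∫ ω, F (X ω) (Y ω) ∂P = ∫ p, Function.uncurry F p ∂((P.map X) ⊗ₘ κ) := by
    rw [← HasLaw.map_eq h, integral_map (HasLaw.aemeasurable h) hF.aestronglyMeasurable]
    rfl
  rw [h1, Measure.integral_compProd hbd, integral_map hX]
  · rfl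
  · exact hF.stronglyMeasurable.integral_kernel_prod_right'.aestronglyMeasurable

/-- Kronecker's lemma, with a weight sequence that is only assumed monotone and unbounded. -/
theorem tendsto_sum_mul_div_of_tendsto {b T : ℕ → ℝ} (hb : Monotone b) (hb0 : ∀ n, 0 < b n)
    (hbt : Tendsto b atTop atTop) {c : ℝ} (hT : Tendsto T atTop (𝓝 c)) :
    Tendsto (fun n => (∑ k ∈ Finset.range n, b k * (T (k + 1) - T k)) / b n) atTop (𝓝 0) := by
  -- summation by parts
  have hparts : ∀ n, ∑ k ∈ Finset.range n, b k * (T (k + 1) - T k) =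
      b n * (T n - c) - b 0 * (T 0 - c) -
        ∑ k ∈ Finset.range n, (b (k + 1) - b k) * (T (k + 1) - c) := by
    intro n
    induction n with
    | zero => simp
    | succ n ih => rw [Finset.sum_range_succ, Finset.sum_range_succ, ih]; ring
  have hsum : ∀ n, ∑ k ∈ Finset.range n, (b (k + 1) - b k) = b n - b 0 :=
    fun n => Finset.sum_range_sub b n
  have hT0 : Tendsto (fun n => T n - c) atTop (𝓝 0) := by simpa using hT.sub_const c
  have hlit : (fun n => ∑ k ∈ Finset.range n, (b (k + 1) - b k) * (T (k + 1) - c)) =o[atTop]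
      fun n => ∑ k ∈ Finset.range n, (b (k + 1) - b k) := by
    refine Asymptotics.IsLittleO.sum_range ?_ (fun n => sub_nonneg.2 (hb n.le_succ)) ?_
    · have : (fun n => T (n + 1) - c) =o[atTop] fun _ => (1 : ℝ) :=
        (Asymptotics.isLittleO_one_iff ℝ).2 ((tendsto_add_atTop_iff_nat 1).2 hT0)
      simpa using (Asymptotics.isBigO_refl (fun n => b (n + 1) - b n) atTop).mul_isLittleO this
    · simp only [hsum]
      exact tendsto_atTop_add_const_right _ _ hbt
  have hbig : (fun n => ∑ k ∈ Finset.range n, (b (k + 1) - b k)) =O[atTop] b := by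
    refine Asymptotics.IsBigO.of_bound 1 (Eventually.of_forall fun n => ?_)
    rw [hsum, Real.norm_of_nonneg (sub_nonneg.2 (hb n.zero_le)), Real.norm_of_nonneg (hb0 n).le]
    linarith [hb0 0]
  have h1 := (hlit.trans_isBigO hbig).tendsto_div_nhds_zero
  have h2 : Tendsto (fun n => b 0 * (T 0 - c) / b n) atTop (𝓝 0) := hbt.const_div_atTop _
  have h3 := (hT0.sub h2).sub h1
  simp only [sub_zero] at h3
  refine h3.congr fun n => ?_
  rw [hparts n, sub_div, sub_div, mul_div_cancel_left₀ _ (hb0 n).ne']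

/-! ### Rank-one updates and sub-Gaussian bounds -/

section RankOne

open Matrix

lemma posDef_add_vecMulVec {ι : Type*} [Finite ι] {V : Matrix ι ι ℝ} (hV : V.PosDef)
    (x : ι → ℝ) : (V + vecMulVec x x).PosDef := by
  have := posSemidef_vecMulVec_self_star x
  exact hV.add_posSemidef (by simpa using this)

variable {ι : Type*} [Fintype ι] [DecidableEq ι] {V : Matrix ι ι ℝ}

lemma dotProduct_inv_comm (hV : V.PosDef) (x y : ι → ℝ) :
    x ⬝ᵥ V⁻¹ *ᵥ y = y ⬝ᵥ V⁻¹ *ᵥ x := by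
  have h : (V⁻¹)ᵀ = V⁻¹ := by simpa using hV.inv.isHermitian.eq
  rw [dotProduct_mulVec, ← mulVec_transpose, h, dotProduct_comm]

lemma dotProduct_inv_nonneg (hV : V.PosDef) (x : ι → ℝ) : 0 ≤ x ⬝ᵥ V⁻¹ *ᵥ x := by
  simpa using hV.inv.posSemidef.dotProduct_mulVec_nonneg x

/-- Rank-one update of the determinant. -/
lemma det_add_vecMulVec (hV : V.PosDef) (x : ι → ℝ) :
    (V + vecMulVec x x).det = V.det * (1 + x ⬝ᵥ V⁻¹ *ᵥ x) := by
  rw [vecMulVec_eq Unit, det_add_replicateCol_mul_replicateRow hV.det_pos.ne'.isUnit]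
  simp [Matrix.mul_assoc, dotProduct, mulVec, Matrix.mul_apply]

/-- Rank-one update of a quadratic form `s ↦ sᵀ V⁻¹ s`, when `V` becomes `V + x xᵀ` and `s` becomes
`s + e x`. -/
lemma quadForm_inv_add_vecMulVec (hV : V.PosDef) (x s : ι → ℝ) (e : ℝ) :
    (s + e • x) ⬝ᵥ (V + vecMulVec x x)⁻¹ *ᵥ (s + e • x) =
      s ⬝ᵥ V⁻¹ *ᵥ s + (2 * (x ⬝ᵥ V⁻¹ *ᵥ s) * e - (x ⬝ᵥ V⁻¹ *ᵥ s) ^ 2 +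
        e ^ 2 * (x ⬝ᵥ V⁻¹ *ᵥ x)) / (1 + x ⬝ᵥ V⁻¹ *ᵥ x) := by
  set w := x ⬝ᵥ V⁻¹ *ᵥ x with hw
  set a := x ⬝ᵥ V⁻¹ *ᵥ s with ha
  have hw0 : 0 < 1 + w := by have := dotProduct_inv_nonneg hV x; linarith
  have hdet : IsUnit V.det := hV.det_pos.ne'.isUnit
  have hdet' : IsUnit (V + vecMulVec x x).det := (posDef_add_vecMulVec hV x).det_pos.ne'.isUnit
  have hinv : (V + vecMulVec x x)⁻¹ *ᵥ (s + e • x) =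
      V⁻¹ *ᵥ s + ((e - a) / (1 + w)) • (V⁻¹ *ᵥ x) := by
    have : (V + vecMulVec x x) *ᵥ (V⁻¹ *ᵥ s + ((e - a) / (1 + w)) • (V⁻¹ *ᵥ x)) = s + e • x := by
      rw [add_mulVec, mulVec_add, mulVec_smul, mulVec_mulVec, mulVec_mulVec, mul_nonsing_inv _ hdet,
        one_mulVec, one_mulVec, vecMulVec_mulVec, dotProduct_add, dotProduct_smul, ← hw, ← ha]
      ext i
      simp
      field_simp
      ring
    rw [← this, mulVec_mulVec, nonsing_inv_mul _ hdet', one_mulVec]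
  rw [hinv, dotProduct_add, dotProduct_smul, add_dotProduct, add_dotProduct, smul_dotProduct,
    smul_dotProduct, dotProduct_inv_comm hV s x, ← hw, ← ha]
  simp only [smul_eq_mul]
  field_simp
  ring

end RankOne

lemma exp_le_add_exp_sq (x : ℝ) : Real.exp x ≤ x + Real.exp (x ^ 2) := by
  have h2 := Real.add_one_le_exp (x ^ 2)
  rcases le_total |x| 1 with h | h
  · have := (abs_le.1 (Real.abs_exp_sub_one_sub_id_le h)).2
    linarith
  · rcases le_total 0 x with h0 | h0
    · rw [abs_of_nonneg h0] at h
      have := Real.exp_le_exp.2 (show x ≤ x ^ 2 by nlinarith)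
      linarith
    · rw [abs_of_nonpos h0] at h
      have := Real.exp_le_one_iff.2 h0
      nlinarith

/-- A centered Bernoulli variable is sub-Gaussian. -/
lemma bernoulli_exp_le {p : ℝ} (h0 : 0 ≤ p) (h1 : p ≤ 1) (t : ℝ) :
    p * Real.exp (t * (1 - p)) + (1 - p) * Real.exp (t * (0 - p)) ≤ Real.exp (t ^ 2) := by
  have key : ∀ e : ℝ, |e| ≤ 1 → Real.exp (t * e) ≤ t * e + Real.exp (t ^ 2) := fun e he => by
    refine (exp_le_add_exp_sq _).trans (add_le_add le_rfl (Real.exp_le_exp.2 ?_))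
    rw [mul_pow]
    exact mul_le_of_le_one_right (sq_nonneg t) ((sq_le_one_iff_abs_le_one _).2 he)
  have e1 := mul_le_mul_of_nonneg_left (key (1 - p) (abs_le.2 ⟨by linarith, by linarith⟩)) h0
  have e2 := mul_le_mul_of_nonneg_left (key (0 - p) (abs_le.2 ⟨by linarith, by linarith⟩))
    (sub_nonneg.2 h1)
  linarith

/-- One step of the supermartingale that controls the ridge regression error: `a` and `w` are the
quantities of the rank-one update, `l` and `D` the quadratic form and the determinant before it. -/
lemma bernoulli_exp_quadForm_step_le {p a w l D : ℝ} (h0 : 0 ≤ p) (h1 : p ≤ 1) (hw : 0 ≤ w)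
    (hD : 0 < D) :
    p * Real.exp (1 / 4 * (l + (2 * a * (1 - p) - a ^ 2 + (1 - p) ^ 2 * w) / (1 + w) -
        Real.log (D * (1 + w)))) +
      (1 - p) * Real.exp (1 / 4 * (l + (2 * a * (0 - p) - a ^ 2 + (0 - p) ^ 2 * w) / (1 + w) -
        Real.log (D * (1 + w)))) ≤ Real.exp (1 / 4 * (l - Real.log D)) := by
  have hw1 : 0 < 1 + w := by linarith
  have hlog : w / (1 + w) ≤ Real.log (1 + w) := by
    have := Real.one_sub_inv_le_log_of_pos hw1
    have h2 : w / (1 + w) = 1 - (1 + w)⁻¹ := by field_simp; ring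
    linarith
  have key : ∀ e : ℝ, e ^ 2 ≤ 1 →
      Real.exp (1 / 4 * (l + (2 * a * e - a ^ 2 + e ^ 2 * w) / (1 + w) - Real.log (D * (1 + w)))) ≤
        Real.exp (1 / 4 * (l - Real.log D)) *
          (Real.exp (a / (2 * (1 + w)) * e) * Real.exp (-(a / (2 * (1 + w))) ^ 2)) := by
    intro e he
    rw [← Real.exp_add, ← Real.exp_add, Real.exp_le_exp, Real.log_mul hD.ne' hw1.ne']
    have e1 : e ^ 2 * w / (1 + w) ≤ w / (1 + w) := by
      gcongr
      exact mul_le_of_le_one_left hw he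
    have e2 : (a / (2 * (1 + w))) ^ 2 ≤ 1 / 4 * (a ^ 2 / (1 + w)) := by
      rw [div_pow, div_le_iff₀ (by positivity)]
      have : 1 / 4 * (a ^ 2 / (1 + w)) * (2 * (1 + w)) ^ 2 = a ^ 2 * (1 + w) := by
        field_simp; ring
      rw [this]
      nlinarith [sq_nonneg a]
    have e3 : (2 * a * e - a ^ 2 + e ^ 2 * w) / (1 + w) =
        4 * (a / (2 * (1 + w)) * e) - a ^ 2 / (1 + w) + e ^ 2 * w / (1 + w) := by
      field_simp; ring
    rw [e3]
    linarith
  have b := bernoulli_exp_le h0 h1 (a / (2 * (1 + w)))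
  have k1 := mul_le_mul_of_nonneg_left (key (1 - p) (by nlinarith)) h0
  have k2 := mul_le_mul_of_nonneg_left (key (0 - p) (by nlinarith)) (sub_nonneg.2 h1)
  have b2 := mul_le_mul_of_nonneg_left b
    (Real.exp_pos (1 / 4 * (l - Real.log D) - (a / (2 * (1 + w))) ^ 2)).le
  rw [← Real.exp_add, sub_add_cancel, sub_eq_add_neg, Real.exp_add] at b2
  calc _ ≤ _ := add_le_add k1 k2
    _ = _ := by ring
    _ ≤ _ := b2

/-! ### Growth of the ridge regression estimates -/

section DesignMatrix

open Matrix

variable {S A : Type*} [Fintype S] [Fintype A] [DecidableEq S] [DecidableEq A] {h n : ℕ}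
  {θ : Hyper S A}

lemma posDef_smul_one_add_sum {ι κ : Type*} [Fintype ι] [DecidableEq ι] {lam : ℝ} (hlam : 0 < lam)
    (x : κ → ι → ℝ) (s : Finset κ) :
    (lam • (1 : Matrix ι ι ℝ) + ∑ k ∈ s, vecMulVec (x k) (x k)).PosDef ∧
      lam ^ Fintype.card ι ≤ (lam • (1 : Matrix ι ι ℝ) + ∑ k ∈ s, vecMulVec (x k) (x k)).det := by
  classical
  induction s using Finset.induction_on with
  | empty => simpa [det_smul] using PosDef.one.smul hlam
  | insert k s hk ih =>
    rw [Finset.sum_insert hk, add_comm (vecMulVec _ _), ← add_assoc]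
    refine ⟨posDef_add_vecMulVec ih.1 _, ih.2.trans ?_⟩
    rw [det_add_vecMulVec ih.1]
    exact le_mul_of_one_le_right ih.1.det_pos.le
      (le_add_of_nonneg_right (dotProduct_inv_nonneg ih.1 _))

lemma posDef_designMatrix (hlam : 0 < θ.lam) (H : History S A h n) : (designMatrix θ H).PosDef :=
  (posDef_smul_one_add_sum hlam _ _).1

lemma pow_le_det_designMatrix (hlam : 0 < θ.lam) (H : History S A h n) :
    θ.lam ^ Fintype.card (S × A) ≤ (designMatrix θ H).det :=
  (posDef_smul_one_add_sum hlam _ _).2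

lemma dotProduct_designMatrix_mulVec (H : History S A h n) (v : S × A → ℝ) :
    v ⬝ᵥ designMatrix θ H *ᵥ v =
      θ.lam * (v ⬝ᵥ v) + ∑ k, ((fun q => obs H k q) ⬝ᵥ v) ^ 2 := by
  rw [designMatrix, add_mulVec, dotProduct_add, smul_mulVec, dotProduct_smul, one_mulVec,
    sum_mulVec, dotProduct_sum, smul_eq_mul]
  congr 1
  refine Finset.sum_congr rfl fun k _ => ?_
  rw [vecMulVec_mulVec, dotProduct_smul, dotProduct_comm v]
  simp [sq]

lemma le_dotProduct_designMatrix_mulVec (H : History S A h n) (v : S × A → ℝ) :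
    θ.lam * (v ⬝ᵥ v) ≤ v ⬝ᵥ designMatrix θ H *ᵥ v := by
  rw [dotProduct_designMatrix_mulVec]
  exact le_add_of_nonneg_right (Finset.sum_nonneg fun k _ => sq_nonneg _)

/-- The residual `∑ₖ yₖ xₖ - M r` of the regression equations at the utilities `r`. -/
def residual (θ : Hyper S A) (r : EuclideanSpace ℝ (S × A)) (H : History S A h n) : S × A → ℝ :=
  (fun q => ∑ k, lab H k * obs H k q) - designMatrix θ H *ᵥ fun q => r q

/-- The squared error `‖r̂ - r‖²_M` of the ridge regression estimate, in terms of the residual. -/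
def sqError (θ : Hyper S A) (r : EuclideanSpace ℝ (S × A)) (H : History S A h n) : ℝ :=
  residual θ r H ⬝ᵥ (designMatrix θ H)⁻¹ *ᵥ residual θ r H

lemma norm_rewardMAP_le (hlam : 1 ≤ θ.lam) (r : EuclideanSpace ℝ (S × A)) (H : History S A h n) :
    ‖rewardMAP θ H‖ ≤ ‖r‖ + √(sqError θ r H) := by
  have hlam0 : 0 < θ.lam := by linarith
  set V := designMatrix θ H with hV
  have hpd : V.PosDef := posDef_designMatrix hlam0 H
  have hdet : IsUnit V.det := hpd.det_pos.ne'.isUnit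
  set b := V⁻¹ *ᵥ residual θ r H with hb
  have hmap : rewardMAP θ H = r + WithLp.toLp 2 b := by
    ext q
    have : b = V⁻¹ *ᵥ (fun q => ∑ k, lab H k * obs H k q) - fun q => r q := by
      rw [hb, residual, mulVec_sub, mulVec_mulVec, nonsing_inv_mul _ hdet, one_mulVec]
    simp [this, rewardMAP, ← hV]
  have hQ : sqError θ r H = b ⬝ᵥ V *ᵥ b := by
    rw [sqError, ← hV, ← hb, hb, mulVec_mulVec, mul_nonsing_inv _ hdet, one_mulVec,
      dotProduct_comm]
  have hbb : b ⬝ᵥ b ≤ sqError θ r H := by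
    rw [hQ]
    refine le_trans ?_ (le_dotProduct_designMatrix_mulVec H b)
    exact le_mul_of_one_le_left (by simpa using dotProduct_star_self_nonneg b) hlam
  rw [hmap]
  refine (norm_add_le _ _).trans (add_le_add le_rfl ?_)
  rw [EuclideanSpace.norm_eq]
  refine Real.sqrt_le_sqrt (le_trans (le_of_eq ?_) hbb)
  simp [dotProduct, sq]

/-- The difference of the visit counts of the two trajectories of an iteration. -/
def feature (τ : Fin 2 → Traj S A h) : S × A → ℝ := fun q => (visits (τ 1) - visits (τ 0)) q

lemma designMatrix_hist_succ (θ : Hyper S A) (z : ℕ → (Fin 2 → Traj S A h) × Bool) (n : ℕ) :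
    designMatrix θ (hist z (n + 1)) =
      designMatrix θ (hist z n) + vecMulVec (feature (z n).1) (feature (z n).1) := by
  rw [designMatrix, Fin.sum_univ_castSucc, ← add_assoc]
  rfl

lemma residual_hist_succ (θ : Hyper S A) (r : EuclideanSpace ℝ (S × A))
    (z : ℕ → (Fin 2 → Traj S A h) × Bool) (n : ℕ) :
    residual θ r (hist z (n + 1)) = residual θ r (hist z n) +
      ((if (z n).2 = true then 1 else 0) -
        (inner ℝ r (visits ((z n).1 1) - visits ((z n).1 0)) + 1 / 2)) • feature (z n).1 := by
  have hin : feature (z n).1 ⬝ᵥ (fun q => r q) =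
      inner ℝ r (visits ((z n).1 1) - visits ((z n).1 0)) := by
    simp [feature, PiLp.inner_apply, dotProduct]
  have hlab : ∀ q, (∑ k, lab (hist z (n + 1)) k * obs (hist z (n + 1)) k q) =
      (∑ k, lab (hist z n) k * obs (hist z n) k q) +
        ((if (z n).2 = true then 1 else 0) - 1 / 2) * feature (z n).1 q := by
    intro q
    rw [Fin.sum_univ_castSucc]
    rfl
  ext q
  rw [residual, designMatrix_hist_succ, add_mulVec, vecMulVec_mulVec, hin]
  simp only [residual, Pi.sub_apply, Pi.add_apply, Pi.smul_apply, hlab, smul_eq_mul,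
    MulOpposite.smul_eq_mul_unop, MulOpposite.unop_op]
  ring

/-- A lower bound for the factor `β` that does not depend on the history. -/
def betaLower (θ : Hyper S A) : ℝ := θ.R * √(2 * Real.log (1 / θ.δ))

lemma betaLower_pos (hR : 0 < θ.R) (hδ0 : 0 < θ.δ) (hδ1 : θ.δ < 1) : 0 < betaLower θ := by
  have : 0 < Real.log (1 / θ.δ) := Real.log_pos ((one_lt_div hδ0).2 hδ1)
  unfold betaLower
  positivity

lemma log_in_beta (hlam : 0 < θ.lam) (hδ0 : 0 < θ.δ) (H : History S A h n) :
    2 * Real.log ((designMatrix θ H).det ^ (1 / 2 : ℝ) *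
      θ.lam ^ (-(Fintype.card (S × A) : ℝ) / 2) / θ.δ) =
    Real.log (designMatrix θ H).det - Fintype.card (S × A) * Real.log θ.lam +
      2 * Real.log (1 / θ.δ) := by
  have hd := (posDef_designMatrix hlam H).det_pos
  rw [Real.log_div (by positivity) hδ0.ne', Real.log_mul (by positivity) (by positivity),
    Real.log_rpow hd, Real.log_rpow hlam, one_div, one_div, Real.log_inv]
  ring

lemma card_mul_log_le_log_det (hlam : 0 < θ.lam) (H : History S A h n) :
    Fintype.card (S × A) * Real.log θ.lam ≤ Real.log (designMatrix θ H).det := by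
  rw [← Real.log_pow]
  exact Real.log_le_log (by positivity) (pow_le_det_designMatrix hlam H)

lemma betaLower_le_beta (hlam : 0 < θ.lam) (hR : 0 < θ.R) (hSr : 0 ≤ θ.Sr) (hδ0 : 0 < θ.δ)
    (H : History S A h n) : betaLower θ ≤ beta θ H := by
  rw [beta, log_in_beta hlam hδ0, betaLower]
  have h1 := card_mul_log_le_log_det hlam H
  have h2 : 0 ≤ √θ.lam * θ.Sr := by positivity
  refine le_add_of_le_of_nonneg (mul_le_mul_of_nonneg_left (Real.sqrt_le_sqrt ?_) hR.le) h2
  linarith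

lemma log_det_le_beta_sq (hlam : 0 < θ.lam) (hR : 0 < θ.R) (hSr : 0 ≤ θ.Sr) (hδ0 : 0 < θ.δ)
    (hδ1 : θ.δ < 1) (H : History S A h n) :
    Real.log (designMatrix θ H).det ≤
      beta θ H ^ 2 / θ.R ^ 2 + Fintype.card (S × A) * Real.log θ.lam := by
  have h1 := card_mul_log_le_log_det hlam H
  have h3 : 0 < Real.log (1 / θ.δ) := Real.log_pos ((one_lt_div hδ0).2 hδ1)
  set L := Real.log (designMatrix θ H).det - Fintype.card (S × A) * Real.log θ.lam +
      2 * Real.log (1 / θ.δ) with hL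
  have hb : θ.R * √L ≤ beta θ H := by
    rw [beta, log_in_beta hlam hδ0]
    exact le_add_of_nonneg_right (by positivity)
  have hsq : θ.R ^ 2 * L ≤ beta θ H ^ 2 := by
    have := pow_le_pow_left₀ (by positivity) hb 2
    rwa [mul_pow, Real.sq_sqrt (by linarith)] at this
  rw [← sub_le_iff_le_add, le_div_iff₀ (by positivity)]
  refine le_trans ?_ hsq
  nlinarith [sq_nonneg θ.R]

end DesignMatrix

section Run

variable {S A : Type*} [Fintype S] [Fintype A] [DecidableEq S] [DecidableEq A]
  [MeasurableSpace S] [MeasurableSpace A] [MeasurableSingletonClass S]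
  [MeasurableSingletonClass A] {h : ℕ}
  {M : PrefMDP S A h} {θ : Hyper S A} {Ω : Type*} [MeasurableSpace Ω] {P : Measure Ω}
  [IsProbabilityMeasure P] {samp : ℕ → Ω → Samples S A} {pol : ℕ → Ω → Fin 2 → Policy S A h}
  {traj : ℕ → Ω → Fin 2 → Traj S A h} {label : ℕ → Ω → Bool}

/-- What is observed in the iterations of a run. -/
def record (traj : ℕ → Ω → Fin 2 → Traj S A h) (label : ℕ → Ω → Bool) (ω : Ω) (k : ℕ) :
    (Fin 2 → Traj S A h) × Bool :=
  (traj k ω, label k ω)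

lemma IsDPS.aemeasurable_record (hD : IsDPS M θ P samp pol traj label) (k : ℕ) :
    AEMeasurable (fun ω => record traj label ω k) P :=
  (hD.traj_law k).aemeasurable_snd.prodMk (hD.label_law k).aemeasurable_snd

instance (n : ℕ) : IsMarkovKernel (prefKernel M n) := by
  unfold prefKernel
  have : IsMarkovKernel (Kernel.ofFunOfCountable fun τ : Fin 2 → Traj S A h =>
    bernoulliMeasure true false (M.pref (τ 1) (τ 0))) := ⟨fun τ => by
      change IsProbabilityMeasure (bernoulliMeasure true false (M.pref (τ 1) (τ 0)))
      infer_instance⟩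
  infer_instance

lemma IsDPS.integral_label (hD : IsDPS M θ P samp pol traj label) (n : ℕ)
    (G : History S A h n → (Fin 2 → Traj S A h) → Bool → ℝ) :
    ∫ ω, G (hist (record traj label ω) n) (traj n ω) (label n ω) ∂P =
      ∫ ω, ((M.pref (traj n ω 1) (traj n ω 0) : ℝ) *
          G (hist (record traj label ω) n) (traj n ω) true +
        (1 - (M.pref (traj n ω 1) (traj n ω 0) : ℝ)) *
          G (hist (record traj label ω) n) (traj n ω) false) ∂P := by
  obtain ⟨C, hC⟩ := (Set.finite_range fun p : History S A h n × (Fin 2 → Traj S A h) × Bool =>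
    |G p.1 p.2.1 p.2.2|).bddAbove
  have hm : Measurable fun p : History S A h n × (Fin 2 → Traj S A h) × Bool =>
    G p.1 p.2.1 p.2.2 := measurable_of_countable _
  have := integral_of_hasCondDistrib (hD.label_law n)
    (F := fun x b => G x.1.1 x.2 b)
    (hm.comp (f := fun q : ((History S A h n × Samples S A × (Fin 2 → Policy S A h)) ×
      (Fin 2 → Traj S A h)) × Bool => (q.1.1.1, q.1.2, q.2)) (by fun_prop))
    C fun x b => hC ⟨(x.1.1, x.2, b), rfl⟩
  refine this.trans (integral_congr_ae (ae_of_all _ fun ω => ?_))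
  change ∫ y, _ ∂(bernoulliMeasure true false (M.pref (traj n ω 1) (traj n ω 0))) = _
  rw [integral_bernoulliMeasure]
  rfl

/-- Almost surely, the reward estimates grow at most like the factors `β`. -/
theorem IsDPS.ae_norm_rewardMAP_le (hD : IsDPS M θ P samp pol traj label)
    {rbar : EuclideanSpace ℝ (S × A)} (hlink : M.HasLinearLink rbar)
    (hlam : 1 ≤ θ.lam) (hR : 0 < θ.R) (hSr : 0 ≤ θ.Sr) (hδ0 : 0 < θ.δ) (hδ1 : θ.δ < 1) :
    ∀ᵐ ω ∂P, ∃ K : ℕ, ∀ n, ‖rewardMAP θ (hist (record traj label ω) n)‖ ≤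
      K * beta θ (hist (record traj label ω) n) := by
  have hlam0 : 0 < θ.lam := by linarith
  let W : ∀ n, History S A h n → ℝ := fun n H =>
    Real.exp (1 / 4 * (sqError θ rbar H - Real.log (designMatrix θ H).det))
  have hW : ∀ n H, 0 ≤ W n H := fun n H => (Real.exp_pos _).le
  have hz := hD.aemeasurable_record
  have hint : ∀ n (f : History S A h n → ℝ),
      Integrable (fun ω => f (hist (record traj label ω) n)) P :=
    fun n f => integrable_of_finite_range (aemeasurable_hist hz n) f
  have hsuper : ∀ n (g : History S A h n → ℝ), (∀ H, 0 ≤ g H) →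
      ∫ ω, g (hist (record traj label ω) n) * W (n + 1) (hist (record traj label ω) (n + 1)) ∂P ≤
        ∫ ω, g (hist (record traj label ω) n) * W n (hist (record traj label ω) n) ∂P := by
    intro n g hg
    let G : History S A h n → (Fin 2 → Traj S A h) → Bool → ℝ := fun H τ b =>
      let w := feature τ ⬝ᵥ (designMatrix θ H)⁻¹.mulVec (feature τ)
      let a := feature τ ⬝ᵥ (designMatrix θ H)⁻¹.mulVec (residual θ rbar H)
      let e := (if b = true then 1 else 0) - (M.pref (τ 1) (τ 0) : ℝ)
      g H * Real.exp (1 / 4 * (sqError θ rbar H + (2 * a * e - a ^ 2 + e ^ 2 * w) / (1 + w) -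
        Real.log ((designMatrix θ H).det * (1 + w))))
    have hstep : ∀ ω, g (hist (record traj label ω) n) *
        W (n + 1) (hist (record traj label ω) (n + 1)) =
        G (hist (record traj label ω) n) (traj n ω) (label n ω) := by
      intro ω
      have hpd := posDef_designMatrix hlam0 (hist (record traj label ω) n)
      simp only [W, G, sqError]
      rw [designMatrix_hist_succ, residual_hist_succ, ← hlink, quadForm_inv_add_vecMulVec hpd,
        det_add_vecMulVec hpd]
      rfl
    rw [integral_congr_ae (ae_of_all _ hstep), hD.integral_label n G]
    refine integral_mono_ae ?_ (hint n fun H => g H * W n H) (ae_of_all _ fun ω => ?_)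
    · exact integrable_of_finite_range (Z := fun ω => (hist (record traj label ω) n, traj n ω))
        ((aemeasurable_hist hz n).prodMk (hD.traj_law n).aemeasurable_snd)
        fun p : History S A h n × (Fin 2 → Traj S A h) =>
          (M.pref (p.2 1) (p.2 0) : ℝ) * G p.1 p.2 true +
            (1 - (M.pref (p.2 1) (p.2 0) : ℝ)) * G p.1 p.2 false
    · have hpd := posDef_designMatrix hlam0 (hist (record traj label ω) n)
      have := mul_le_mul_of_nonneg_left (bernoulli_exp_quadForm_step_le
        (M.pref (traj n ω 1) (traj n ω 0)).2.1 (M.pref (traj n ω 1) (traj n ω 0)).2.2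
        (dotProduct_inv_nonneg hpd (feature (traj n ω))) hpd.det_pos
        (a := feature (traj n ω) ⬝ᵥ (designMatrix θ (hist (record traj label ω) n))⁻¹.mulVec
          (residual θ rbar (hist (record traj label ω) n)))
        (l := sqError θ rbar (hist (record traj label ω) n)))
        (hg (hist (record traj label ω) n))
      refine le_trans (le_of_eq ?_) this
      simp only [G]
      simp only [if_true, Bool.false_eq_true, if_false]
      ring
  have hbd : ∀ n, ∫ ω, W n (hist (record traj label ω) n) ∂P ≤
      ∫ ω, W 0 (hist (record traj label ω) 0) ∂P := by
    intro n
    induction n with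
    | zero => exact le_rfl
    | succ n ih => exact le_trans (by simpa using hsuper n (fun _ => 1) fun _ => zero_le_one) ih
  have hconv := ae_exists_tendsto_hist hz (fun n H => - W n H)
    (fun n g hg => by
      have h1 := hsuper n g hg
      rw [← sub_nonneg, ← integral_sub (hint n fun H => g H * W n H)] at h1
      · refine h1.trans_eq (integral_congr_ae (ae_of_all _ fun ω => ?_))
        change _ - _ = _
        ring
      · exact hint (n + 1) fun H => g (fun k => H k.castSucc) * W (n + 1) H)
    _ (fun n => by simpa only [abs_neg, abs_of_nonneg (hW _ _)] using hbd n)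
  filter_upwards [hconv] with ω ⟨c, hc⟩
  obtain ⟨C, hC⟩ := hc.neg.bddAbove_range
  have hC1 : ∀ n, W n (hist (record traj label ω) n) ≤ max C 1 := fun n =>
    le_max_of_le_left (hC ⟨n, by simp⟩)
  have hβ0 := betaLower_pos hR hδ0 hδ1
  set L := 4 * Real.log (max C 1) + Fintype.card (S × A) * Real.log θ.lam with hLdef
  have hL0 : 0 ≤ L := by
    have := Real.log_nonneg (le_max_right C 1)
    have := Real.log_nonneg hlam
    positivity
  have hQ : ∀ n, sqError θ rbar (hist (record traj label ω) n) ≤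
      (L / betaLower θ ^ 2 + 1 / θ.R ^ 2) * beta θ (hist (record traj label ω) n) ^ 2 := by
    intro n
    have h1 := (Real.le_log_iff_exp_le (by positivity)).2 (hC1 n)
    have h2 := log_det_le_beta_sq hlam0 hR hSr hδ0 hδ1 (hist (record traj label ω) n)
    have h3 := betaLower_le_beta hlam0 hR hSr hδ0 (hist (record traj label ω) n)
    have h4 : L ≤ L / betaLower θ ^ 2 * beta θ (hist (record traj label ω) n) ^ 2 := by
      rw [div_mul_eq_mul_div, le_div_iff₀ (by positivity)]
      gcongr
    have h5 : beta θ (hist (record traj label ω) n) ^ 2 / θ.R ^ 2 =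
      1 / θ.R ^ 2 * beta θ (hist (record traj label ω) n) ^ 2 := by ring
    rw [add_mul]
    linarith
  obtain ⟨K, hK⟩ := exists_nat_ge (‖rbar‖ / betaLower θ + √(L / betaLower θ ^ 2 + 1 / θ.R ^ 2))
  refine ⟨K, fun n => (norm_rewardMAP_le hlam rbar _).trans ?_⟩
  have h3 := betaLower_le_beta hlam0 hR hSr hδ0 (hist (record traj label ω) n)
  have hβ : 0 < beta θ (hist (record traj label ω) n) := hβ0.trans_le h3
  have e1 : ‖rbar‖ ≤ ‖rbar‖ / betaLower θ * beta θ (hist (record traj label ω) n) := by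
    rw [div_mul_eq_mul_div, le_div_iff₀ hβ0]
    gcongr
  have e2 := Real.sqrt_le_sqrt (hQ n)
  rw [Real.sqrt_mul (by positivity), Real.sqrt_sq hβ.le] at e2
  calc _ ≤ _ := add_le_add e1 e2
    _ = (‖rbar‖ / betaLower θ + √(L / betaLower θ ^ 2 + 1 / θ.R ^ 2)) *
      beta θ (hist (record traj label ω) n) := by ring
    _ ≤ _ := mul_le_mul_of_nonneg_right hK hβ.le

end Run

/-! ### Markov chains and transition frequencies -/

section Chains

variable {S : Type*} [Fintype S]

lemma sum_chain_cons {n : ℕ} (F : (Fin (n + 2) → S) → ℝ) :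
    ∑ σ, F σ = ∑ s, ∑ σ : Fin (n + 1) → S, F (Fin.cons s σ) := by
  rw [← (Fin.consEquiv (fun _ : Fin (n + 2) => S)).sum_comp, Fintype.sum_prod_type]
  rfl

/-- Summing path weights with stochastic transition matrices leaves the mass of the initial
weights, which need not be a probability distribution. -/
lemma sum_chain : ∀ {h : ℕ} (q : S → ℝ) (k : Fin h → S → S → ℝ),
    (∀ t s, ∑ s', k t s s' = 1) →
      ∑ σ : Fin (h + 1) → S, q (σ 0) * ∏ t : Fin h, k t (σ t.castSucc) (σ t.succ) = ∑ s, q s := by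
  intro h
  induction h with
  | zero =>
    intro q k _
    rw [← (Equiv.funUnique (Fin 1) S).symm.sum_comp]
    simp
  | succ n ih =>
    intro q k hk
    rw [sum_chain_cons]
    refine Finset.sum_congr rfl fun s _ => ?_
    have hs := ih (k 0 s) (fun t => k t.succ) fun t => hk t.succ
    rw [hk 0 s] at hs
    calc _ = ∑ σ : Fin (n + 1) → S, q s *
          (k 0 s (σ 0) * ∏ t : Fin n, k t.succ (σ t.castSucc) (σ t.succ)) := by
          refine Finset.sum_congr rfl fun σ _ => ?_
          simp [Fin.prod_univ_succ]
      _ = q s := by rw [← Finset.mul_sum, hs, mul_one]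

/-- The Markov property: a function of the transition at time `t` that is centered given the state
at time `t` is centered. -/
lemma sum_chain_mul_eq_zero : ∀ {h : ℕ} (q : S → ℝ) (k : Fin h → S → S → ℝ),
    (∀ t s, ∑ s', k t s s' = 1) → ∀ (t : Fin h) (f : S → S → ℝ),
      (∀ s, ∑ s', k t s s' * f s s' = 0) →
      ∑ σ : Fin (h + 1) → S, (q (σ 0) * ∏ u : Fin h, k u (σ u.castSucc) (σ u.succ)) *
        f (σ t.castSucc) (σ t.succ) = 0 := by
  intro h
  induction h with
  | zero => exact fun _ _ _ t => t.elim0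
  | succ n ih =>
    intro q k hk t f hf
    rw [sum_chain_cons]
    refine Finset.sum_eq_zero fun s _ => ?_
    obtain rfl | ⟨t, rfl⟩ := t.eq_zero_or_eq_succ
    · have hs := sum_chain (fun s' => k 0 s s' * f s s') (fun t => k t.succ) fun t => hk t.succ
      rw [hf s] at hs
      rw [← mul_zero (q s), ← hs, Finset.mul_sum]
      refine Finset.sum_congr rfl fun σ _ => ?_
      simp [Fin.prod_univ_succ]
      ring
    · have hs := ih (k 0 s) (fun t => k t.succ) (fun t => hk t.succ) t f hf
      rw [← mul_zero (q s), ← hs, Finset.mul_sum]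
      refine Finset.sum_congr rfl fun σ _ => ?_
      simp [Fin.prod_univ_succ]
      ring

end Chains

section Rollout

variable {S A : Type*} [Fintype S] {h : ℕ} (M : PrefMDP S A h)

lemma PrefMDP.sum_dyn (s : S) (a : A) : ∑ s', M.dyn s a s' = 1 := by
  have h1 : ∑ s', M.p s a s' = 1 := by simpa [tsum_fintype] using (M.p s a).tsum_coe
  rw [← ENNReal.toReal_one, ← h1, ENNReal.toReal_sum fun _ _ => PMF.apply_ne_top _ _]
  rfl

lemma PrefMDP.sum_init : ∑ s, M.init s = 1 := by
  have h1 : ∑ s', M.p₀ s' = 1 := by simpa [tsum_fintype] using M.p₀.tsum_coe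
  rw [← ENNReal.toReal_one, ← h1, ENNReal.toReal_sum fun _ _ => PMF.apply_ne_top _ _]
  rfl

lemma sum_pathWeight {p : S → A → S → ℝ} (hp : ∀ s a, ∑ s', p s a s' = 1) (π : Policy S A h) :
    ∑ σ, pathWeight M.init p π σ = 1 := by
  rw [← M.sum_init]
  exact sum_chain M.init (fun t s => p s (π s t)) fun t s => hp _ _

lemma toReal_pathWeight (π : Policy S A h) (σ : Fin (h + 1) → S) :
    (pathWeight (fun s => M.p₀ s) (fun s a s' => M.p s a s') π σ).toReal =
      pathWeight M.init M.dyn π σ := by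
  simp [pathWeight, ENNReal.toReal_prod, PrefMDP.init, PrefMDP.dyn]

variable [MeasurableSpace S] [MeasurableSpace A] [MeasurableSingletonClass S]
  [MeasurableSingletonClass A] [Finite A]

lemma integral_rollout (π : Policy S A h) (F : Traj S A h → ℝ) :
    ∫ τ, F τ ∂(M.rollout π).toMeasure =
      ∑ σ, pathWeight M.init M.dyn π σ * F (σ, fun t => π (σ t.castSucc) t) := by
  have hm : Measurable fun σ : Fin (h + 1) → S =>
      ((σ, fun t => π (σ t.castSucc) t) : Traj S A h) := measurable_of_countable _
  rw [PrefMDP.rollout, ← PMF.toMeasure_map _ _ hm, integral_map hm.aemeasurable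
    (measurable_of_countable F).aestronglyMeasurable, PMF.integral_eq_sum]
  refine Finset.sum_congr rfl fun σ _ => ?_
  exact congrArg (· * F (σ, fun t => π (σ t.castSucc) t)) (toReal_pathWeight M π σ)

end Rollout

section Counts

variable {S A : Type*} [DecidableEq S] [DecidableEq A] {h n : ℕ}

/-- The number of visits to `(s, a)` in the history. -/
def visitCount (H : History S A h n) (s : S) (a : A) : ℝ := ∑ k, ∑ j, visits ((H k).1 j) (s, a)

/-- The number of transitions from `(s, a)` to `s'` in the history. -/
def transCount (H : History S A h n) (s : S) (a : A) (s' : S) : ℝ :=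
  ∑ k, ∑ j, (transitions ((H k).1 j) s a s' : ℝ)

/-- The number of transitions from `(s, a)` to `s'` in a trajectory, centered by its compensator. -/
def excess (M : PrefMDP S A h) (τ : Traj S A h) (s : S) (a : A) (s' : S) : ℝ :=
  transitions τ s a s' - M.dyn s a s' * visits τ (s, a)

lemma visits_apply (τ : Traj S A h) (q : S × A) :
    visits τ q = ∑ t : Fin h, if (τ.1 t.castSucc, τ.2 t) = q then (1 : ℝ) else 0 := rfl

lemma visits_nonneg (τ : Traj S A h) (q : S × A) : 0 ≤ visits τ q := by
  rw [visits_apply]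
  exact Finset.sum_nonneg fun t _ => by split_ifs <;> norm_num

lemma visits_le (τ : Traj S A h) (q : S × A) : visits τ q ≤ h := by
  rw [visits_apply]
  refine (Finset.sum_le_sum (g := fun _ => (1 : ℝ)) fun t _ => ?_).trans (by simp)
  split_ifs <;> norm_num

lemma excess_eq_sum (M : PrefMDP S A h) (τ : Traj S A h) (s : S) (a : A) (s' : S) :
    excess M τ s a s' = ∑ t : Fin h, (if (τ.1 t.castSucc, τ.2 t) = (s, a) then 1 else 0) *
      ((if τ.1 t.succ = s' then 1 else 0) - M.dyn s a s') := by
  rw [excess, visits_apply, transitions, Nat.cast_sum, Finset.mul_sum, ← Finset.sum_sub_distrib]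
  refine Finset.sum_congr rfl fun t _ => ?_
  by_cases h1 : τ.1 t.castSucc = s <;> by_cases h2 : τ.2 t = a <;> simp [h1, h2]

lemma abs_excess_le [Fintype S] (M : PrefMDP S A h) (τ : Traj S A h) (s : S) (a : A) (s' : S) :
    |excess M τ s a s'| ≤ visits τ (s, a) := by
  rw [excess_eq_sum, visits_apply]
  refine (Finset.abs_sum_le_sum_abs _ _).trans (Finset.sum_le_sum fun t _ => ?_)
  have h0 : 0 ≤ M.dyn s a s' := ENNReal.toReal_nonneg
  have h1 : M.dyn s a s' ≤ 1 := by
    rw [← M.sum_dyn s a]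
    exact Finset.single_le_sum (fun x _ => (ENNReal.toReal_nonneg : 0 ≤ M.dyn s a x))
      (Finset.mem_univ s')
  rw [abs_mul]
  split_ifs <;> simp <;> rw [abs_le] <;> constructor <;> linarith

lemma visitCount_nonneg (H : History S A h n) (s : S) (a : A) : 0 ≤ visitCount H s a :=
  Finset.sum_nonneg fun _ _ => Finset.sum_nonneg fun _ _ => visits_nonneg _ _

lemma visitCount_hist_succ (z : ℕ → (Fin 2 → Traj S A h) × Bool) (n : ℕ) (s : S) (a : A) :
    visitCount (hist z (n + 1)) s a =
      visitCount (hist z n) s a + ∑ j, visits ((z n).1 j) (s, a) := by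
  rw [visitCount, Fin.sum_univ_castSucc]
  rfl

lemma transCount_sub_eq_sum (M : PrefMDP S A h) (z : ℕ → (Fin 2 → Traj S A h) × Bool) (n : ℕ)
    (s : S) (a : A) (s' : S) :
    transCount (hist z n) s a s' - M.dyn s a s' * visitCount (hist z n) s a =
      ∑ k ∈ Finset.range n, ∑ j, excess M ((z k).1 j) s a s' := by
  rw [Finset.sum_range, transCount, visitCount, Finset.mul_sum, ← Finset.sum_sub_distrib]
  refine Finset.sum_congr rfl fun k _ => ?_
  rw [Finset.mul_sum, ← Finset.sum_sub_distrib]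
  rfl

/-- The normalized martingale `∑ₖ Dₖ / (1 + Nₖ)` built from the excesses `Dₖ` and the visit counts
`Nₖ` before iteration `k`. -/
def normExcess (M : PrefMDP S A h) (s : S) (a : A) (s' : S) (n : ℕ) (H : History S A h n) : ℝ :=
  ∑ k : Fin n, (∑ j, excess M ((H k).1 j) s a s') /
    (1 + visitCount (fun i : Fin k => H (Fin.castLE k.2.le i)) s a)

lemma normExcess_hist_succ (M : PrefMDP S A h) (z : ℕ → (Fin 2 → Traj S A h) × Bool) (n : ℕ)
    (s : S) (a : A) (s' : S) :
    normExcess M s a s' (n + 1) (hist z (n + 1)) = normExcess M s a s' n (hist z n) +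
      (∑ j, excess M ((z n).1 j) s a s') / (1 + visitCount (hist z n) s a) := by
  rw [normExcess, Fin.sum_univ_castSucc]
  rfl

/-- The squared increments of the normalized martingale telescope. -/
lemma sq_excess_div_le [Fintype S] (M : PrefMDP S A h) (τ : Fin 2 → Traj S A h) (s : S) (a : A)
    (s' : S) {N : ℝ} (hN : 0 ≤ N) :
    ((∑ j, excess M (τ j) s a s') / (1 + N)) ^ 2 ≤ 2 * h * (1 + 2 * h) *
      (1 / (1 + N) - 1 / (1 + (N + ∑ j, visits (τ j) (s, a)))) := by
  set v := ∑ j, visits (τ j) (s, a) with hv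
  have hv0 : 0 ≤ v := Finset.sum_nonneg fun _ _ => visits_nonneg _ _
  have hvh : v ≤ 2 * h := by
    rw [hv, Fin.sum_univ_two]
    linarith [visits_le (τ 0) (s, a), visits_le (τ 1) (s, a)]
  have hD : |∑ j, excess M (τ j) s a s'| ≤ v :=
    (Finset.abs_sum_le_sum_abs _ _).trans (Finset.sum_le_sum fun j _ => abs_excess_le _ _ _ _ _)
  have hD2 : (∑ j, excess M (τ j) s a s') ^ 2 ≤ v ^ 2 := by
    rw [← sq_abs]
    exact pow_le_pow_left₀ (abs_nonneg _) hD 2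
  have e1 : 1 / (1 + N) - 1 / (1 + (N + v)) = v / ((1 + N) * (1 + N + v)) := by
    have : 1 + (N + v) ≠ 0 := by positivity
    have : 1 + N + v ≠ 0 := by positivity
    field_simp
    ring
  rw [e1, div_pow, ← mul_div_assoc, div_le_div_iff₀ (by positivity) (by positivity)]
  have e2 : 1 + N + v ≤ (1 + 2 * h) * (1 + N) := by nlinarith
  have e3 : v ^ 2 ≤ 2 * h * v := by nlinarith
  calc _ ≤ (2 * h * v) * ((1 + N) * ((1 + 2 * h) * (1 + N))) :=
        mul_le_mul (hD2.trans e3) (by gcongr) (by positivity) (by positivity)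
    _ = _ := by ring

end Counts

section Frequencies

variable {S A : Type*} [Fintype S] [Fintype A] [DecidableEq S] [DecidableEq A]
  [MeasurableSpace S] [MeasurableSpace A] [MeasurableSingletonClass S]
  [MeasurableSingletonClass A] {h : ℕ}
  {M : PrefMDP S A h} {θ : Hyper S A} {Ω : Type*} [MeasurableSpace Ω] {P : Measure Ω}
  [IsProbabilityMeasure P] {samp : ℕ → Ω → Samples S A} {pol : ℕ → Ω → Fin 2 → Policy S A h}
  {traj : ℕ → Ω → Fin 2 → Traj S A h} {label : ℕ → Ω → Bool}

lemma integral_excess (M : PrefMDP S A h) (π : Policy S A h) (s : S) (a : A) (s' : S) :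
    ∫ τ, excess M τ s a s' ∂(M.rollout π).toMeasure = 0 := by
  rw [integral_rollout]
  simp only [excess_eq_sum, Finset.mul_sum]
  rw [Finset.sum_comm]
  refine Finset.sum_eq_zero fun t _ => ?_
  refine sum_chain_mul_eq_zero M.init (fun t s => M.dyn s (π s t)) (fun t s => M.sum_dyn _ _) t
    (fun x y => (if (x, π x t) = (s, a) then 1 else 0) *
      ((if y = s' then 1 else 0) - M.dyn s a s')) fun x => ?_
  by_cases hx : (x, π x t) = (s, a)
  · obtain ⟨rfl, rfl⟩ := Prod.mk.inj hx
    simp [mul_sub, Finset.sum_sub_distrib, ← Finset.sum_mul, M.sum_dyn]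
  · simp [hx]

instance (n : ℕ) : IsMarkovKernel (rolloutKernel M n) := by
  unfold rolloutKernel
  have : IsMarkovKernel (Kernel.ofFunOfCountable fun π : Fin 2 → Policy S A h =>
    Measure.pi fun j => (M.rollout (π j)).toMeasure) := ⟨fun π => by
      change IsProbabilityMeasure (Measure.pi fun j => (M.rollout (π j)).toMeasure)
      infer_instance⟩
  infer_instance

lemma IsDPS.integral_traj (hD : IsDPS M θ P samp pol traj label) (n : ℕ)
    (G : History S A h n → (Fin 2 → Traj S A h) → ℝ) :
    ∫ ω, G (hist (record traj label ω) n) (traj n ω) ∂P =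
      ∫ ω, ∫ τ, G (hist (record traj label ω) n) τ
        ∂(Measure.pi fun j => (M.rollout (pol n ω j)).toMeasure) ∂P := by
  obtain ⟨C, hC⟩ := (Set.finite_range fun p : History S A h n × (Fin 2 → Traj S A h) =>
    |G p.1 p.2|).bddAbove
  have hm : Measurable fun p : History S A h n × (Fin 2 → Traj S A h) => G p.1 p.2 :=
    measurable_of_countable _
  exact integral_of_hasCondDistrib (hD.traj_law n) (F := fun x τ => G x.1 τ)
    (hm.comp (f := fun q : (History S A h n × Samples S A × (Fin 2 → Policy S A h)) ×
      (Fin 2 → Traj S A h) => (q.1.1, q.2)) (by fun_prop))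
    C fun x τ => hC ⟨(x.1, τ), rfl⟩

lemma IsDPS.integral_mul_excess (hD : IsDPS M θ P samp pol traj label) (s : S) (a : A) (s' : S)
    (n : ℕ) (g : History S A h n → ℝ) :
    ∫ ω, g (hist (record traj label ω) n) * ∑ j, excess M (traj n ω j) s a s' ∂P = 0 := by
  rw [hD.integral_traj n fun H τ => g H * ∑ j, excess M (τ j) s a s', integral_eq_zero_of_ae]
  refine ae_of_all _ fun ω => ?_
  simp only [Pi.zero_apply]
  rw [integral_const_mul, integral_finsetSum _ fun j _ => Integrable.of_finite,
    Finset.sum_eq_zero, mul_zero]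
  intro j _
  rw [integral_comp_eval (μ := fun j => (M.rollout (pol n ω j)).toMeasure) (i := j)
    (f := fun τ => excess M τ s a s') (measurable_of_countable _).aestronglyMeasurable]
  exact integral_excess M _ s a s'

/-- Strong law of large numbers: the empirical transition frequencies at a state-action pair
converge almost surely on the event that it is visited infinitely often. -/
theorem IsDPS.ae_tendsto_transCount_div (hD : IsDPS M θ P samp pol traj label) :
    ∀ᵐ ω ∂P, ∀ s a s',
      Tendsto (fun n => visitCount (hist (record traj label ω) n) s a) atTop atTop →
      Tendsto (fun n => transCount (hist (record traj label ω) n) s a s' /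
        (1 + visitCount (hist (record traj label ω) n) s a)) atTop (𝓝 (M.dyn s a s')) := by
  simp only [ae_all_iff]
  intro s a s'
  have hz := hD.aemeasurable_record
  have hint : ∀ n (f : History S A h n → ℝ),
      Integrable (fun ω => f (hist (record traj label ω) n)) P :=
    fun n f => integrable_of_finite_range (aemeasurable_hist hz n) f
  have hint' : ∀ n (f : History S A h n → (Fin 2 → Traj S A h) → ℝ),
      Integrable (fun ω => f (hist (record traj label ω) n) (traj n ω)) P :=
    fun n f => integrable_of_finite_range (Z := fun ω => (hist (record traj label ω) n, traj n ω))
      ((aemeasurable_hist hz n).prodMk (hD.traj_law n).aemeasurable_snd)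
      fun p : History S A h n × (Fin 2 → Traj S A h) => f p.1 p.2
  set T := normExcess M s a s' with hT
  have hmart : ∀ n (g : History S A h n → ℝ), ∫ ω, g (hist (record traj label ω) n) *
      ((∑ j, excess M (traj n ω j) s a s') /
        (1 + visitCount (hist (record traj label ω) n) s a)) ∂P = 0 := by
    intro n g
    rw [← hD.integral_mul_excess s a s' n fun H => g H / (1 + visitCount H s a)]
    refine integral_congr_ae (ae_of_all _ fun ω => ?_)
    simp only
    ring
  have hL2 : ∀ n, ∫ ω, T n (hist (record traj label ω) n) ^ 2 ∂P ≤
      ∫ ω, 2 * h * (1 + 2 * h) *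
        (1 - 1 / (1 + visitCount (hist (record traj label ω) n) s a)) ∂P := by
    intro n
    induction n with
    | zero => simp [hT, normExcess, visitCount]
    | succ n ih =>
      have e1 : ∀ ω, T (n + 1) (hist (record traj label ω) (n + 1)) ^ 2 =
          T n (hist (record traj label ω) n) ^ 2 +
          2 * T n (hist (record traj label ω) n) * ((∑ j, excess M (traj n ω j) s a s') /
            (1 + visitCount (hist (record traj label ω) n) s a)) +
          ((∑ j, excess M (traj n ω j) s a s') /
            (1 + visitCount (hist (record traj label ω) n) s a)) ^ 2 := by
        intro ω
        rw [hT, normExcess_hist_succ]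
        simp only [record]
        ring
      have i1 := hint n fun H => T n H ^ 2
      have i2 := hint' n fun H τ => 2 * T n H * ((∑ j, excess M (τ j) s a s') /
            (1 + visitCount H s a))
      have i3 := hint' n fun H τ => ((∑ j, excess M (τ j) s a s') / (1 + visitCount H s a)) ^ 2
      have i12 := hint' n fun H τ => T n H ^ 2 + 2 * T n H * ((∑ j, excess M (τ j) s a s') /
            (1 + visitCount H s a))
      rw [integral_congr_ae (ae_of_all _ e1), integral_add i12 i3, integral_add i1 i2,
        hmart n fun H => 2 * T n H, add_zero]
      have e2 : ∫ ω, ((∑ j, excess M (traj n ω j) s a s') /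
            (1 + visitCount (hist (record traj label ω) n) s a)) ^ 2 ∂P ≤
          ∫ ω, 2 * h * (1 + 2 * h) * (1 / (1 + visitCount (hist (record traj label ω) n) s a) -
            1 / (1 + visitCount (hist (record traj label ω) (n + 1)) s a)) ∂P := by
        refine integral_mono i3 (hint (n + 1) fun H => 2 * h * (1 + 2 * h) *
          (1 / (1 + visitCount (fun k => H k.castSucc) s a) - 1 / (1 + visitCount H s a)))
          fun ω => ?_
        simp only
        rw [visitCount_hist_succ]
        exact sq_excess_div_le M _ s a s' (visitCount_nonneg _ _ _)
      refine (add_le_add ih e2).trans_eq ?_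
      refine (integral_add
        (hint n fun H => 2 * h * (1 + 2 * h) * (1 - 1 / (1 + visitCount H s a)))
        (hint (n + 1) fun H => 2 * h * (1 + 2 * h) *
          (1 / (1 + visitCount (fun k => H k.castSucc) s a) -
            1 / (1 + visitCount H s a)))).symm.trans ?_
      refine integral_congr_ae (ae_of_all _ fun ω => ?_)
      change 2 * h * (1 + 2 * h) * (1 - 1 / (1 + visitCount (hist (record traj label ω) n) s a)) +
        2 * h * (1 + 2 * h) * (1 / (1 + visitCount (hist (record traj label ω) n) s a) -
          1 / (1 + visitCount (hist (record traj label ω) (n + 1)) s a)) = _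
      ring
  have hconv := ae_exists_tendsto_hist hz T (fun n g _ => by
      refine le_of_eq ?_
      rw [← hmart n g]
      refine integral_congr_ae (ae_of_all _ fun ω => ?_)
      simp only
      rw [hT, normExcess_hist_succ, add_sub_cancel_left]
      rfl) (1 + 2 * h * (1 + 2 * h)) (fun n => by
      calc ∫ ω, |T n (hist (record traj label ω) n)| ∂P
          ≤ ∫ ω, (1 + T n (hist (record traj label ω) n) ^ 2) ∂P := by
            refine integral_mono (hint n fun H => |T n H|) (hint n fun H => 1 + T n H ^ 2)
              fun ω => ?_
            simp only
            rw [← sq_abs (T n _)]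
            nlinarith [sq_nonneg (|T n (hist (record traj label ω) n)| - 1),
              sq_nonneg (|T n (hist (record traj label ω) n)|)]
        _ = 1 + ∫ ω, T n (hist (record traj label ω) n) ^ 2 ∂P := by
            rw [integral_add (integrable_const _) (hint n fun H => T n H ^ 2)]
            simp
        _ ≤ 1 + ∫ ω, (2 * h * (1 + 2 * h) : ℝ) ∂P := by
            refine add_le_add le_rfl ((hL2 n).trans (integral_mono
              (hint n fun H => 2 * h * (1 + 2 * h) * (1 - 1 / (1 + visitCount H s a)))
              (integrable_const _) fun ω => ?_))
            have := visitCount_nonneg (hist (record traj label ω) n) s a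
            have : 0 ≤ 1 / (1 + visitCount (hist (record traj label ω) n) s a) := by positivity
            exact mul_le_of_le_one_right (by positivity) (by linarith)
        _ = _ := by simp)
  filter_upwards [hconv] with ω ⟨c, hc⟩ hvis
  set z := record traj label ω with hzdef
  have hpos : ∀ n, 0 < 1 + visitCount (hist z n) s a := fun n => by
    have := visitCount_nonneg (hist z n) s a
    positivity
  have hbt : Tendsto (fun n => 1 + visitCount (hist z n) s a) atTop atTop :=
    tendsto_atTop_add_const_left _ _ hvis
  have hkron := tendsto_sum_mul_div_of_tendsto (b := fun n => 1 + visitCount (hist z n) s a)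
    (monotone_nat_of_le_succ fun n => by
      rw [visitCount_hist_succ]
      have : 0 ≤ ∑ j, visits ((z n).1 j) (s, a) := Finset.sum_nonneg fun _ _ => visits_nonneg _ _
      linarith) hpos hbt hc
  have h3 : Tendsto (fun n => M.dyn s a s' / (1 + visitCount (hist z n) s a)) atTop (𝓝 0) :=
    hbt.const_div_atTop _
  have h4 := (hkron.add_const (M.dyn s a s')).sub h3
  simp only [zero_add, sub_zero] at h4
  refine h4.congr fun n => ?_
  have h5 : ∑ k ∈ Finset.range n, (1 + visitCount (hist z k) s a) *
      (T (k + 1) (hist z (k + 1)) - T k (hist z k)) =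
      transCount (hist z n) s a s' - M.dyn s a s' * visitCount (hist z n) s a := by
    rw [transCount_sub_eq_sum]
    refine Finset.sum_congr rfl fun k _ => ?_
    rw [hT, normExcess_hist_succ, add_sub_cancel_left, mul_div_cancel₀ _ (hpos k).ne']
  rw [h5]
  field_simp [(hpos n).ne']
  ring

end Frequencies

/-! ### Concentration of Dirichlet distributions -/

section Gamma

open Set

lemma measurable_gammaPDF (a r : ℝ) : Measurable (gammaPDF a r) :=
  (measurable_gammaPDFReal a r).ennreal_ofReal

lemma integral_gammaMeasure {a : ℝ} (ha : 0 < a) (f : ℝ → ℝ) :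
    ∫ x, f x ∂(gammaMeasure a 1) =
      (Real.Gamma a)⁻¹ * ∫ x in Ioi 0, x ^ (a - 1) * Real.exp (-(1 * x)) * f x := by
  have hpdf : ∀ x, (gammaPDF a 1 x).toReal = gammaPDFReal a 1 x := fun x =>
    ENNReal.toReal_ofReal (gammaPDFReal_nonneg ha one_pos x)
  rw [gammaMeasure, integral_withDensity_eq_integral_toReal_smul
    (measurable_gammaPDF a 1) (ae_of_all _ fun x => ENNReal.ofReal_lt_top),
    ← integral_Ici_eq_integral_Ioi, ← integral_const_mul, ← integral_indicator measurableSet_Ici]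
  refine integral_congr_ae (ae_of_all _ fun x => ?_)
  simp only [hpdf, gammaPDFReal, smul_eq_mul, indicator, mem_Ici, Real.one_rpow]
  split_ifs <;> ring

lemma ae_nonneg_gammaMeasure (a : ℝ) : ∀ᵐ x ∂(gammaMeasure a 1), 0 ≤ x := by
  rw [gammaMeasure, ae_withDensity_iff (measurable_gammaPDF a 1)]
  exact ae_of_all _ fun x hx => not_lt.1 fun h => hx (gammaPDF_of_neg h)

lemma ae_pos_gammaMeasure (a : ℝ) : ∀ᵐ x ∂(gammaMeasure a 1), 0 < x := by
  have h0 : ∀ᵐ x ∂(gammaMeasure a 1), x ≠ 0 := by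
    have : ∀ᵐ x ∂(volume : Measure ℝ), x ≠ 0 := by simp [ae_iff]
    exact (withDensity_absolutelyContinuous _ _).ae_le this
  filter_upwards [h0, ae_nonneg_gammaMeasure a] with x h1 h2
  exact lt_of_le_of_ne h2 h1.symm

lemma integral_sq_sub_gammaMeasure {a : ℝ} (ha : 0 < a) (m : ℝ) :
    Integrable (fun x => (x - m) ^ 2) (gammaMeasure a 1) ∧
    ∫ x, (x - m) ^ 2 ∂(gammaMeasure a 1) = a + (a - m) ^ 2 := by
  have hGa := (Real.Gamma_pos_of_pos ha).ne'
  have e0 := Real.integral_rpow_mul_exp_neg_mul_Ioi ha one_pos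
  have e1 := Real.integral_rpow_mul_exp_neg_mul_Ioi (a := a + 1) (by linarith) one_pos
  have e2 := Real.integral_rpow_mul_exp_neg_mul_Ioi (a := a + 2) (by linarith) one_pos
  have hG1 : Real.Gamma (a + 1) = a * Real.Gamma a := Real.Gamma_add_one ha.ne'
  have hG2 : Real.Gamma (a + 2) = (a + 1) * (a * Real.Gamma a) := by
    rw [← hG1, ← Real.Gamma_add_one (by linarith)]; ring_nf
  simp only [div_one, Real.one_rpow, one_mul] at e0 e1 e2
  have hint : ∀ b : ℝ, 0 < b →
      IntegrableOn (fun x : ℝ => x ^ (b - 1) * Real.exp (-x)) (Ioi 0) := fun b hb => by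
    simpa [mul_comm] using Real.GammaIntegral_convergent hb
  have i0 := hint a ha
  have i1 := hint (a + 1) (by linarith)
  have i2 := hint (a + 2) (by linarith)
  have hexp : ∀ x ∈ Ioi (0 : ℝ), x ^ (a - 1) * Real.exp (-x) * (x - m) ^ 2 =
      x ^ (a + 2 - 1) * Real.exp (-x) - 2 * m * (x ^ (a + 1 - 1) * Real.exp (-x)) +
        m ^ 2 * (x ^ (a - 1) * Real.exp (-x)) := by
    intro x (hx : 0 < x)
    have r1 : x ^ (a + 1 - 1) = x ^ (a - 1) * x := by
      rw [← Real.rpow_add_one hx.ne']; ring_nf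
    have r2 : x ^ (a + 2 - 1) = x ^ (a - 1) * x * x := by
      rw [← Real.rpow_add_one hx.ne', ← Real.rpow_add_one hx.ne']; ring_nf
    rw [r1, r2]
    ring
  have i12 : IntegrableOn (fun x : ℝ => x ^ (a + 2 - 1) * Real.exp (-x) -
      2 * m * (x ^ (a + 1 - 1) * Real.exp (-x))) (Ioi 0) := i2.sub (i1.const_mul _)
  have i3 : IntegrableOn (fun x : ℝ => m ^ 2 * (x ^ (a - 1) * Real.exp (-x))) (Ioi 0) :=
    i0.const_mul _
  have hval : ∫ x, (x - m) ^ 2 ∂(gammaMeasure a 1) = a + (a - m) ^ 2 := by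
    rw [integral_gammaMeasure ha]
    simp only [one_mul]
    rw [setIntegral_congr_fun measurableSet_Ioi hexp, integral_add i12 i3,
      integral_sub i2 (i1.const_mul _), integral_const_mul, integral_const_mul, e0, e1, e2, hG2,
      hG1]
    field_simp
    ring
  refine ⟨?_, hval⟩
  -- a function with a nonzero Bochner integral is integrable
  by_contra hni
  rw [integral_undef hni] at hval
  nlinarith [sq_nonneg (a - m)]

/-- Chebyshev's inequality for a Gamma variable. -/
lemma gammaMeasure_abs_div_sub_ge_le {a N p ε : ℝ} (ha : 0 < a) (hN : 0 < N) (hε : 0 < ε) :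
    (gammaMeasure a 1).real {x | ε ≤ |x / N - p|} ≤
      (a / N * (1 / N) + (a / N - p) ^ 2) / ε ^ 2 := by
  have : IsProbabilityMeasure (gammaMeasure a 1) := isProbabilityMeasure_gammaMeasure ha one_pos
  obtain ⟨hi, hv⟩ := integral_sq_sub_gammaMeasure ha (N * p)
  have hm := mul_meas_ge_le_integral_of_nonneg (ae_of_all _ fun x => sq_nonneg (x - N * p)) hi
    ((N * ε) ^ 2)
  have hset : {x | ε ≤ |x / N - p|} = {x : ℝ | (N * ε) ^ 2 ≤ (x - N * p) ^ 2} := by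
    ext x
    have e : x / N - p = (x - N * p) / N := by field_simp
    simp only [mem_ofPred_eq]
    rw [e, abs_div, abs_of_pos hN, le_div_iff₀ hN, sq_le_sq, abs_of_pos (mul_pos hN hε), mul_comm]
  rw [hset, le_div_iff₀ (by positivity)]
  rw [hv] at hm
  have e1 : (a / N * (1 / N) + (a / N - p) ^ 2) = (a + (a - N * p) ^ 2) / N ^ 2 := by
    field_simp
  rw [e1, le_div_iff₀ (by positivity)]
  calc _ = (N * ε) ^ 2 * (gammaMeasure a 1).real {x : ℝ | (N * ε) ^ 2 ≤ (x - N * p) ^ 2} := by ring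
    _ ≤ _ := hm

end Gamma

section Dirichlet

variable {ι : Type*} [Fintype ι]

lemma measurable_normalize : Measurable fun (g : ι → ℝ) k => g k / ∑ l, g l := by
  fun_prop

lemma isProbabilityMeasure_dirichlet {α : ι → ℝ} (hα : ∀ k, 0 < α k) :
    IsProbabilityMeasure (dirichlet α) := by
  have : ∀ k, IsProbabilityMeasure (gammaMeasure (α k) 1) :=
    fun k => isProbabilityMeasure_gammaMeasure (hα k) one_pos
  exact Measure.isProbabilityMeasure_map measurable_normalize.aemeasurable

/-- A Dirichlet distribution lives on the simplex. -/
lemma ae_dirichlet [Nonempty ι] {α : ι → ℝ} (hα : ∀ k, 0 < α k) :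
    ∀ᵐ x ∂(dirichlet α), (∀ k, 0 ≤ x k) ∧ ∑ k, x k = 1 := by
  have hP : ∀ k, IsProbabilityMeasure (gammaMeasure (α k) 1) :=
    fun k => isProbabilityMeasure_gammaMeasure (hα k) one_pos
  refine (ae_map_iff measurable_normalize.aemeasurable ?_).2 ?_
  · have h1 : MeasurableSet {x : ι → ℝ | ∀ k, 0 ≤ x k} := by
      simp only [Set.ofPred_forall]
      exact MeasurableSet.iInter fun k => measurableSet_le measurable_const (measurable_pi_apply k)
    have h2 : MeasurableSet {x : ι → ℝ | ∑ k, x k = 1} :=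
      measurableSet_eq_fun (by fun_prop) measurable_const
    exact h1.inter h2
  · have hall : ∀ᵐ g ∂(Measure.pi fun k => gammaMeasure (α k) 1), ∀ k, 0 < g k :=
      ae_all_iff.2 fun k => Measure.tendsto_eval_ae_ae.eventually (ae_pos_gammaMeasure (α k))
    filter_upwards [hall] with g hg
    have hsum : 0 < ∑ l, g l := Finset.sum_pos (fun k _ => hg k) Finset.univ_nonempty
    refine ⟨fun k => (div_pos (hg k) hsum).le, ?_⟩
    rw [← Finset.sum_div, div_self hsum.ne']

/-- Dirichlet distributions concentrate at the limit of their normalized parameters when the total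
mass of the parameters tends to infinity. -/
theorem tendsto_dirichlet_real_ge {α : ℕ → ι → ℝ} (hα : ∀ n k, 0 < α n k) {N : ℕ → ℝ}
    (hN0 : ∀ n, 0 < N n) (hN : Tendsto N atTop atTop) {p : ι → ℝ} (hp : ∑ k, p k = 1)
    (hαN : ∀ k, Tendsto (fun n => α n k / N n) atTop (𝓝 (p k))) {ε : ℝ} (hε : 0 < ε) (k : ι) :
    Tendsto (fun n => (dirichlet (α n)).real {x | ε ≤ |x k - p k|}) atTop (𝓝 0) := by
  have hP : ∀ n k, IsProbabilityMeasure (gammaMeasure (α n k) 1) :=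
    fun n k => isProbabilityMeasure_gammaMeasure (hα n k) one_pos
  have hcont : ContinuousAt (fun g : ι → ℝ => g k / ∑ l, g l) p := by
    refine ContinuousAt.div (continuous_apply k).continuousAt (by fun_prop) ?_
    rw [hp]; exact one_ne_zero
  obtain ⟨η, hη, hηε⟩ := Metric.continuousAt_iff.1 hcont ε hε
  have hbound : ∀ n, (dirichlet (α n)).real {x | ε ≤ |x k - p k|} ≤
      ∑ l, (α n l / N n * (1 / N n) + (α n l / N n - p l) ^ 2) / η ^ 2 := by
    intro n
    have hms : MeasurableSet {x : ι → ℝ | ε ≤ |x k - p k|} :=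
      measurableSet_le measurable_const (by fun_prop)
    rw [dirichlet, map_measureReal_apply measurable_normalize hms]
    calc _ ≤ (Measure.pi fun l => gammaMeasure (α n l) 1).real
          (⋃ l ∈ Finset.univ, Function.eval l ⁻¹' {x | η ≤ |x / N n - p l|}) := by
          refine measureReal_mono ?_ (measure_ne_top _ _)
          intro g hg
          by_contra hcon
          simp only [Set.mem_iUnion, Finset.mem_univ, Set.mem_preimage, Set.mem_ofPred_eq,
            Function.eval, exists_prop, true_and, not_exists, not_le] at hcon
          have h1 := hηε (x := fun l => g l / N n)
            ((dist_pi_lt_iff hη).2 fun l => by rw [Real.dist_eq]; exact hcon l)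
          rw [Real.dist_eq, hp, div_one, ← Finset.sum_div,
            div_div_div_cancel_right₀ (hN0 n).ne'] at h1
          exact absurd h1 (not_lt.2 hg)
      _ ≤ ∑ l, (Measure.pi fun l => gammaMeasure (α n l) 1).real
          (Function.eval l ⁻¹' {x | η ≤ |x / N n - p l|}) := measureReal_biUnion_finset_le _ _
      _ ≤ _ := by
          refine Finset.sum_le_sum fun l _ => ?_
          rw [(measurePreserving_eval (fun l => gammaMeasure (α n l) 1) l).measureReal_preimage
            (measurableSet_le measurable_const (by fun_prop)).nullMeasurableSet]
          exact gammaMeasure_abs_div_sub_ge_le (hα n l) (hN0 n) hη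
  refine squeeze_zero (fun n => measureReal_nonneg) hbound ?_
  rw [show (0 : ℝ) = ∑ l : ι, (p l * 0 + (p l - p l) ^ 2) / η ^ 2 by simp]
  refine tendsto_finsetSum _ fun l _ => Tendsto.div_const (((hαN l).mul ?_).add
    (((hαN l).sub_const (p l)).pow 2)) _
  simpa using hN.const_div_atTop 1

end Dirichlet

/-! ### Lower bounds for Gaussian measures -/

section Gaussian

open Matrix

variable {ι : Type*} [Fintype ι]

lemma stdGaussian_ball_pos (y : EuclideanSpace ℝ ι) {ε : ℝ} (hε : 0 < ε) :
    0 < (stdGaussian (EuclideanSpace ℝ ι)) (Metric.ball y ε) := by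
  have : (gaussianReal 0 1).IsOpenPosMeasure :=
    (gaussianReal_absolutelyContinuous' 0 one_ne_zero).isOpenPosMeasure
  have hc : Continuous (WithLp.toLp 2 : (ι → ℝ) → EuclideanSpace ℝ ι) :=
    PiLp.continuous_toLp 2 _
  rw [← map_pi_eq_stdGaussian, Measure.map_apply hc.measurable Metric.isOpen_ball.measurableSet]
  exact (Metric.isOpen_ball.preimage hc).measure_pos _
    ⟨WithLp.ofLp y, by simpa using hε⟩

/-- Balls with a fixed radius and centers in a bounded set have uniformly positive Gaussian
measure. -/
lemma exists_le_stdGaussian_ball (K : ℝ) {ε : ℝ} (hε : 0 < ε) :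
    ∃ c > 0, ∀ y : EuclideanSpace ℝ ι, ‖y‖ ≤ K →
      c ≤ (stdGaussian (EuclideanSpace ℝ ι)).real (Metric.ball y ε) := by
  obtain ⟨t, -, htf, ht⟩ := (isCompact_closedBall (0 : EuclideanSpace ℝ ι) K).finite_cover_balls
    (half_pos hε)
  have hpos : ∀ y, 0 < (stdGaussian (EuclideanSpace ℝ ι)).real (Metric.ball y (ε / 2)) := fun y =>
    ENNReal.toReal_pos (stdGaussian_ball_pos y (half_pos hε)).ne' (measure_ne_top _ _)
  obtain ⟨c, hc0, hc⟩ : ∃ c > 0, ∀ y ∈ t,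
      c ≤ (stdGaussian (EuclideanSpace ℝ ι)).real (Metric.ball y (ε / 2)) := by
    rcases t.eq_empty_or_nonempty with rfl | hne
    · exact ⟨1, one_pos, by simp⟩
    · obtain ⟨y, hy, hmin⟩ := htf.exists_minimalFor
        (fun y => (stdGaussian (EuclideanSpace ℝ ι)).real (Metric.ball y (ε / 2))) t hne
      exact ⟨_, hpos y, fun x hx => (le_total _ _).elim id fun h => hmin hx h⟩
  refine ⟨c, hc0, fun y hy => ?_⟩
  obtain ⟨x, hx, hyx⟩ := Set.mem_iUnion₂.1 (ht (mem_closedBall_zero_iff.2 hy))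
  refine (hc x hx).trans (measureReal_mono (Metric.ball_subset_ball' ?_))
  rw [Metric.mem_ball, dist_comm] at hyx
  linarith

variable [DecidableEq ι]

lemma norm_toLp_sq (v : ι → ℝ) : ‖(WithLp.toLp 2 v : EuclideanSpace ℝ ι)‖ ^ 2 = v ⬝ᵥ v := by
  rw [EuclideanSpace.norm_sq_eq]
  simp [dotProduct, sq]

open scoped MatrixOrder in
/-- A Gaussian vector with covariance `C ≤ b²` falls within `b` of a prescribed point with a
probability that is bounded below in terms of the Mahalanobis distance of this point from the
mean. -/
lemma exists_le_multivariateGaussian (K : ℝ) :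
    ∃ c > 0, ∀ (μ : EuclideanSpace ℝ ι) (C : Matrix ι ι ℝ) (b : ℝ) (e : ι → ℝ), C.PosDef →
      0 < b → (∀ v, v ⬝ᵥ C *ᵥ v ≤ b ^ 2 * (v ⬝ᵥ v)) → e ⬝ᵥ C⁻¹ *ᵥ e ≤ K ^ 2 →
      c ≤ (multivariateGaussian μ C).real (Metric.closedBall (μ + WithLp.toLp 2 e) b) := by
  obtain ⟨c, hc0, hc⟩ := exists_le_stdGaussian_ball (ι := ι) |K| one_pos
  refine ⟨c, hc0, fun μ C b e hC hb hCb hCe => ?_⟩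
  set B := CFC.sqrt C with hB
  have hBB : B * B = C := CFC.sqrt_mul_sqrt_self C hC.posSemidef.nonneg
  have hBt : Bᵀ = B := by
    rw [← conjTranspose_eq_transpose_of_trivial]
    exact (CFC.sqrt_nonneg C).isSelfAdjoint.star_eq
  have hBdet : IsUnit B.det := by
    have := hC.det_pos.ne'
    rw [← hBB, det_mul] at this
    exact (left_ne_zero_of_mul this).isUnit
  have hnorm : ∀ v : ι → ℝ, (B *ᵥ v) ⬝ᵥ (B *ᵥ v) = v ⬝ᵥ C *ᵥ v := fun v => by
    rw [← hBB, ← mulVec_mulVec, dotProduct_mulVec v, ← mulVec_transpose, hBt]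
  set y := B⁻¹ *ᵥ e with hy
  have hBy : B *ᵥ y = e := by rw [hy, mulVec_mulVec, mul_nonsing_inv _ hBdet, one_mulVec]
  have hyK : ‖(WithLp.toLp 2 y : EuclideanSpace ℝ ι)‖ ≤ |K| := by
    rw [← sq_le_sq₀ (norm_nonneg _) (abs_nonneg _), norm_toLp_sq, sq_abs]
    refine le_trans (le_of_eq ?_) hCe
    have hCi : C⁻¹ = B⁻¹ * B⁻¹ := by rw [← hBB, Matrix.mul_inv_rev]
    rw [hCi, ← mulVec_mulVec, dotProduct_mulVec e, ← mulVec_transpose, transpose_nonsing_inv, hBt]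
  refine (hc _ hyK).trans ?_
  rw [multivariateGaussian, map_measureReal_apply (by fun_prop)
    Metric.isClosed_closedBall.measurableSet]
  refine measureReal_mono fun x hx => ?_
  rw [Metric.mem_ball, dist_eq_norm] at hx
  rw [Set.mem_preimage, Metric.mem_closedBall, dist_eq_norm, add_sub_add_left_eq_sub]
  obtain ⟨x, rfl⟩ : ∃ x', x = WithLp.toLp 2 x' := ⟨WithLp.ofLp x, rfl⟩
  rw [toEuclideanCLM_toLp, ← WithLp.toLp_sub, ← hB]
  rw [← WithLp.toLp_sub] at hx
  have e1 : B *ᵥ x - e = B *ᵥ (x - y) := by rw [mulVec_sub, hBy]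
  rw [e1, ← sq_le_sq₀ (norm_nonneg _) hb.le, norm_toLp_sq, hnorm]
  refine (hCb _).trans ?_
  rw [← norm_toLp_sq]
  exact mul_le_of_le_one_right (sq_nonneg b) (pow_le_one₀ (norm_nonneg _) hx.le)

end Gaussian

section RewardPosterior

open Matrix

variable {S A : Type*} [Fintype S] [Fintype A] [DecidableEq S] [DecidableEq A] {h : ℕ}
  {θ : Hyper S A}

lemma dotProduct_designMatrix_inv_le {n : ℕ} (hlam : 1 ≤ θ.lam) (H : History S A h n)
    (v : S × A → ℝ) : v ⬝ᵥ (designMatrix θ H)⁻¹ *ᵥ v ≤ v ⬝ᵥ v := by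
  have hpd := posDef_designMatrix (zero_lt_one.trans_le hlam) H
  set V := designMatrix θ H
  set b := V⁻¹ *ᵥ v with hb
  have hVb : V *ᵥ b = v := by
    rw [hb, mulVec_mulVec, mul_nonsing_inv _ hpd.det_pos.ne'.isUnit, one_mulVec]
  have h1 : b ⬝ᵥ b ≤ v ⬝ᵥ b := by
    have h2 := le_dotProduct_designMatrix_mulVec (θ := θ) H b
    have h3 : 0 ≤ b ⬝ᵥ b := by simpa using dotProduct_star_self_nonneg b
    change θ.lam * (b ⬝ᵥ b) ≤ b ⬝ᵥ V *ᵥ b at h2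
    rw [hVb, dotProduct_comm b v] at h2
    nlinarith
  have h4 : 0 ≤ (v - b) ⬝ᵥ (v - b) := by simpa using dotProduct_star_self_nonneg (v - b)
  rw [sub_dotProduct, dotProduct_sub, dotProduct_sub, dotProduct_comm b v] at h4
  linarith

/-- With a probability that is bounded below, the sampled rewards are within `β` of the estimate
shifted by `t β` times a given vector `u`, provided that `‖u‖_M` stays bounded. -/
lemma exists_le_rewardPosterior (hlam : 1 ≤ θ.lam) (u : S × A → ℝ) {t K : ℝ} (hK : 0 ≤ K) :
    ∃ c > 0, ∀ (n : ℕ) (H : History S A h n), 0 < beta θ H → u ⬝ᵥ designMatrix θ H *ᵥ u ≤ K →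
      c ≤ (rewardPosterior θ H).real
        (Metric.closedBall (rewardMAP θ H + WithLp.toLp 2 ((t * beta θ H) • u)) (beta θ H)) := by
  obtain ⟨c, hc0, hc⟩ := exists_le_multivariateGaussian (ι := S × A) (t * √K)
  refine ⟨c, hc0, fun n H hβ hu => ?_⟩
  have hpd := posDef_designMatrix (zero_lt_one.trans_le hlam) H
  refine hc _ _ _ _ (hpd.inv.smul (by positivity)) hβ (fun v => ?_) ?_
  · rw [smul_mulVec, dotProduct_smul, smul_eq_mul]
    exact mul_le_mul_of_nonneg_left (dotProduct_designMatrix_inv_le hlam H v) (sq_nonneg _)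
  · have hinv : (beta θ H ^ 2 • (designMatrix θ H)⁻¹)⁻¹ =
        (beta θ H ^ 2)⁻¹ • designMatrix θ H := by
      refine inv_eq_left_inv ?_
      rw [smul_mul_smul_comm, mul_nonsing_inv _ hpd.det_pos.ne'.isUnit, inv_mul_cancel₀
        (by positivity), one_smul]
    rw [hinv, smul_mulVec, mulVec_smul, dotProduct_smul, dotProduct_smul, smul_dotProduct,
      mul_pow, Real.sq_sqrt hK]
    simp only [smul_eq_mul]
    have : (beta θ H ^ 2)⁻¹ * (t * beta θ H * (t * beta θ H * (u ⬝ᵥ designMatrix θ H *ᵥ u))) =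
        t ^ 2 * (u ⬝ᵥ designMatrix θ H *ᵥ u) := by
      field_simp
    rw [this]
    exact mul_le_mul_of_nonneg_left hu (sq_nonneg t)

end RewardPosterior

/-! ### Exploration in a single iteration -/

section Escape

variable {S A : Type*} [Fintype S] [DecidableEq S] [DecidableEq A] {h : ℕ} (M : PrefMDP S A h)
  (U : Finset (S × A))

/-- The probability that under dynamics `p` the policy `π` stays within the set `U` of state-action
pairs during an episode. -/
def stay (p : S → A → S → ℝ) (π : Policy S A h) : ℝ :=
  ∑ σ : Fin (h + 1) → S, if ∀ t : Fin h, (σ t.castSucc, π (σ t.castSucc) t) ∈ U then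
    pathWeight M.init p π σ else 0

/-- The expected number of visits under dynamics `p` of the policy `π` to pairs outside `U`. -/
def outside (p : S → A → S → ℝ) (π : Policy S A h) : ℝ :=
  ∑ σ : Fin (h + 1) → S, pathWeight M.init p π σ *
    ∑ t : Fin h, if (σ t.castSucc, π (σ t.castSucc) t) ∈ U then 0 else 1

lemma PrefMDP.init_nonneg (s : S) : 0 ≤ M.init s := ENNReal.toReal_nonneg

lemma PrefMDP.dyn_nonneg (s : S) (a : A) (s' : S) : 0 ≤ M.dyn s a s' := ENNReal.toReal_nonneg

lemma pathWeight_nonneg {p : S → A → S → ℝ} (hp : ∀ s a s', 0 ≤ p s a s') (π : Policy S A h)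
    (σ : Fin (h + 1) → S) : 0 ≤ pathWeight M.init p π σ :=
  mul_nonneg (M.init_nonneg _) (Finset.prod_nonneg fun _ _ => hp _ _ _)

variable {M U}

lemma one_sub_stay_le_outside {p : S → A → S → ℝ} (hp : ∀ s a s', 0 ≤ p s a s')
    (hp1 : ∀ s a, ∑ s', p s a s' = 1) (π : Policy S A h) :
    1 - stay M U p π ≤ outside M U p π := by
  rw [← sum_pathWeight M hp1 π, stay, outside, ← Finset.sum_sub_distrib]
  refine Finset.sum_le_sum fun σ _ => ?_
  have hw := pathWeight_nonneg M hp π σ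
  split_ifs with hσ
  · simp [hσ]
  · push Not at hσ
    obtain ⟨t, ht⟩ := hσ
    rw [sub_zero]
    refine le_mul_of_one_le_right hw ?_
    refine le_trans (by simp [ht]) (Finset.single_le_sum (f := fun t : Fin h =>
      if (σ t.castSucc, π (σ t.castSucc) t) ∈ U then (0 : ℝ) else 1)
      (fun t _ => by split_ifs <;> norm_num) (Finset.mem_univ t))

lemma outside_le_mul_one_sub_stay {p : S → A → S → ℝ} (hp : ∀ s a s', 0 ≤ p s a s')
    (hp1 : ∀ s a, ∑ s', p s a s' = 1) (π : Policy S A h) :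
    outside M U p π ≤ h * (1 - stay M U p π) := by
  rw [← sum_pathWeight M hp1 π, stay, outside, ← Finset.sum_sub_distrib, Finset.mul_sum]
  refine Finset.sum_le_sum fun σ _ => ?_
  have hw := pathWeight_nonneg M hp π σ
  split_ifs with hσ
  · simp [hσ]
  · rw [sub_zero, mul_comm]
    refine mul_le_mul_of_nonneg_right ?_ hw
    refine (Finset.sum_le_sum (g := fun _ => (1 : ℝ)) fun t _ => ?_).trans (by simp)
    split_ifs <;> norm_num

/-- The probability of staying within `U` depends only, and continuously, on the dynamics at the
pairs in `U`. -/
lemma exists_abs_stay_sub_lt [Finite A] (M : PrefMDP S A h) (U : Finset (S × A)) {κ : ℝ}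
    (hκ : 0 < κ) :
    ∃ ε > 0, ∀ p : S → A → S → ℝ, (∀ q ∈ U, ∀ s', |p q.1 q.2 s' - M.dyn q.1 q.2 s'| < ε) →
      ∀ π, |stay M U p π - stay M U M.dyn π| < κ := by
  have := Fintype.ofFinite A
  have hcont : ∀ π : Policy S A h, Continuous fun p => stay M U p π := fun π => by
    unfold stay pathWeight
    refine continuous_finsetSum _ fun σ _ => ?_
    split_ifs
    · fun_prop
    · exact continuous_const
  have hev : ∀ᶠ p in 𝓝 M.dyn, ∀ π, |stay M U p π - stay M U M.dyn π| < κ := by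
    refine eventually_all.2 fun π => ?_
    have := (Metric.tendsto_nhds.1 ((hcont π).continuousAt (x := M.dyn))) κ hκ
    simpa only [Real.dist_eq] using this
  obtain ⟨ε, hε, hball⟩ := Metric.eventually_nhds_iff.1 hev
  refine ⟨ε, hε, fun p hp π => ?_⟩
  let p' : S → A → S → ℝ := fun s a => if (s, a) ∈ U then p s a else M.dyn s a
  have hstay : stay M U p π = stay M U p' π := by
    refine Finset.sum_congr rfl fun σ _ => ?_
    split_ifs with hσ
    · simp only [pathWeight, p', hσ, if_true]
    · rfl
  rw [hstay]
  refine hball ((dist_pi_lt_iff hε).2 fun s => (dist_pi_lt_iff hε).2 fun a =>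
    (dist_pi_lt_iff hε).2 fun s' => ?_) π
  by_cases hU : (s, a) ∈ U
  · simp only [p', hU, if_true, Real.dist_eq]
    exact hp _ hU s'
  · simpa [p', hU] using hε

/-- If the rewards are `b` times the indicator of the complement of `U`, up to an error of at most
`ρ`, then the value is `b` times the expected number of visits outside `U`, up to `h ρ`. -/
lemma abs_value_sub_le {p : S → A → S → ℝ} (hp : ∀ s a s', 0 ≤ p s a s')
    (hp1 : ∀ s a, ∑ s', p s a s' = 1) (r : EuclideanSpace ℝ (S × A)) {b ρ : ℝ}
    (hr : ∀ q, |r q - b * (if q ∈ U then 0 else 1)| ≤ ρ) (π : Policy S A h) :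
    |value M.init p r π - b * outside M U p π| ≤ h * ρ := by
  rw [value, outside, Finset.mul_sum, ← Finset.sum_sub_distrib]
  refine (Finset.abs_sum_le_sum_abs _ _).trans ?_
  have hsum : h * ρ = ∑ σ, pathWeight M.init p π σ * (h * ρ) := by
    rw [← Finset.sum_mul, sum_pathWeight M hp1 π, one_mul]
  rw [hsum]
  refine Finset.sum_le_sum fun σ _ => ?_
  rw [mul_left_comm, ← mul_sub, abs_mul, abs_of_nonneg (pathWeight_nonneg M hp π σ)]
  refine mul_le_mul_of_nonneg_left ?_ (pathWeight_nonneg M hp π σ)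
  rw [Finset.mul_sum, ← Finset.sum_sub_distrib]
  refine (Finset.abs_sum_le_sum_abs _ _).trans ((Finset.sum_le_sum fun t _ =>
    hr (σ t.castSucc, π (σ t.castSucc) t)).trans ?_)
  simp

/-- Optimal policies for rewards that strongly favor the complement of `U` leave `U` almost as
likely as any other policy, up to the factor `h`. -/
lemma one_sub_stay_le_of_isOptimalPolicy {p : S → A → S → ℝ} (hp : ∀ s a s', 0 ≤ p s a s')
    (hp1 : ∀ s a, ∑ s', p s a s' = 1) {r : EuclideanSpace ℝ (S × A)} {b ρ : ℝ} (hb : 0 < b)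
    (hr : ∀ q, |r q - b * (if q ∈ U then 0 else 1)| ≤ ρ) {π : Policy S A h}
    (hπ : IsOptimalPolicy M.init p r π) (π' : Policy S A h) :
    1 - stay M U p π' - 2 * h * ρ / b ≤ h * (1 - stay M U p π) := by
  have h1 := (abs_le.1 (abs_value_sub_le (M := M) hp hp1 r hr π)).2
  have h2 := (abs_le.1 (abs_value_sub_le (M := M) hp hp1 r hr π')).1
  have h3 := hπ π'
  have h4 := one_sub_stay_le_outside (M := M) (U := U) hp hp1 π'
  have h5 := outside_le_mul_one_sub_stay (M := M) (U := U) hp hp1 π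
  have h6 : outside M U p π' - 2 * h * ρ / b ≤ outside M U p π := by
    rw [sub_le_iff_le_add, ← sub_le_iff_le_add', le_div_iff₀ hb]
    nlinarith
  linarith

/-- A policy can be made to play a given action in a given reachable state, with positive
probability. -/
lemma PrefMDP.Reachable.exists_stay_lt_one {s : S} (hs : M.Reachable s) {a : A}
    (ha : (s, a) ∉ U) : ∃ π : Policy S A h, stay M U M.dyn π < 1 := by
  obtain ⟨π, τ, t, hτ, rfl⟩ := hs
  obtain ⟨σ, hσ, rfl⟩ : ∃ σ, pathWeight (fun s => M.p₀ s) (fun s a s' => M.p s a s') π σ ≠ 0 ∧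
      (σ, fun t => π (σ t.castSucc) t) = τ := by
    have := (PMF.mem_support_iff _ _).2 hτ
    rw [PrefMDP.rollout, PMF.support_map] at this
    obtain ⟨σ, hσ, h2⟩ := this
    exact ⟨σ, (PMF.mem_support_iff _ _).1 hσ, h2⟩
  have hσ' : pathWeight M.init M.dyn π σ ≠ 0 := by
    rw [← toReal_pathWeight]
    refine ENNReal.toReal_ne_zero.2 ⟨hσ, ENNReal.mul_ne_top (PMF.apply_ne_top _ _)
      (ENNReal.prod_ne_top fun _ _ => PMF.apply_ne_top _ _)⟩
  simp only [pathWeight, mul_ne_zero_iff, Finset.prod_ne_zero_iff, Finset.mem_univ, true_imp_iff]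
    at hσ'
  let π' : Policy S A h := fun x u => if x = σ t.castSucc ∧ u = t then a else π x u
  -- follow `σ` up to time `t`, and the dynamics under the modified policy from then on
  let k : Fin h → S → S → ℝ := fun u x y =>
    if u < t then (if y = σ u.succ then 1 else 0) else M.dyn x (π' x u) y
  have hsum := sum_chain (fun s => if s = σ 0 then (1 : ℝ) else 0) k fun u x => by
    by_cases hu : u < t <;> simp [k, hu, M.sum_dyn]
  rw [Finset.sum_ite_eq' Finset.univ (σ 0), if_pos (Finset.mem_univ _)] at hsum
  obtain ⟨σ', -, hne⟩ := Finset.exists_ne_zero_of_sum_ne_zero (hsum.trans_ne one_ne_zero)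
  simp only [mul_ne_zero_iff, Finset.prod_ne_zero_iff, Finset.mem_univ, true_imp_iff, k] at hne
  have h0 : σ' 0 = σ 0 := by
    by_contra hcon
    simp [hcon] at hne
  have hsucc : ∀ u : Fin h, u < t → σ' u.succ = σ u.succ := fun u hu => by
    by_contra hcon
    have := hne.2 u
    simp [hu, hcon] at this
  have hcast : ∀ u : Fin h, u ≤ t → σ' u.castSucc = σ u.castSucc := fun u hu => by
    obtain ⟨u, hu1⟩ := u
    cases u with
    | zero => exact h0
    | succ u => exact hsucc ⟨u, by omega⟩ (lt_of_lt_of_le (Fin.mk_lt_mk.2 (Nat.lt_succ_self u)) hu)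
  have hw : 0 < pathWeight M.init M.dyn π' σ' := by
    refine lt_of_le_of_ne (pathWeight_nonneg M M.dyn_nonneg _ _) (Ne.symm ?_)
    simp only [pathWeight, mul_ne_zero_iff, Finset.prod_ne_zero_iff, Finset.mem_univ, true_imp_iff]
    refine ⟨by rw [h0]; exact hσ'.1, fun u => ?_⟩
    by_cases hu : u < t
    · rw [hsucc u hu, hcast u hu.le]
      simpa [π', hu.ne] using hσ'.2 u
    · simpa [hu] using hne.2 u
  refine ⟨π', ?_⟩
  rw [← sum_pathWeight M M.sum_dyn π', stay]
  refine Finset.sum_lt_sum (fun σ _ => ?_) ⟨σ', Finset.mem_univ _, ?_⟩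
  · split_ifs
    · exact le_rfl
    · exact pathWeight_nonneg M M.dyn_nonneg _ _
  · rw [if_neg]
    · exact hw
    · intro hall
      have := hall t
      rw [hcast t le_rfl] at this
      simp [π'] at this
      exact ha this

end Escape

section GoodSamples

variable {S A : Type*} [Fintype S] [Fintype A] [DecidableEq S] [DecidableEq A]
  [MeasurableSpace S] [MeasurableSpace A] [MeasurableSingletonClass S]
  [MeasurableSingletonClass A] {h : ℕ} {M : PrefMDP S A h} {θ : Hyper S A}

/-- The trajectories that leave the set `U` of state-action pairs. -/
def leaving (U : Finset (S × A)) : Set (Traj S A h) :=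
  {τ | ∃ t : Fin h, (τ.1 t.castSucc, τ.2 t) ∉ U}

lemma rollout_real_leaving (U : Finset (S × A)) (π : Policy S A h) :
    (M.rollout π).toMeasure.real (leaving U) = 1 - stay M U M.dyn π := by
  classical
  rw [← integral_indicator_one (Set.toFinite _).measurableSet, integral_rollout,
    ← sum_pathWeight M M.sum_dyn π, stay, ← Finset.sum_sub_distrib]
  refine Finset.sum_congr rfl fun σ _ => ?_
  by_cases hσ : ∀ t : Fin h, (σ t.castSucc, π (σ t.castSucc) t) ∈ U
  · simp [leaving, hσ]
  · have hσ' := hσ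
    push Not at hσ'
    simp [leaving, hσ, hσ']

lemma isProbabilityMeasure_posterior_dirichlet (hα : ∀ s a s', 0 < θ.α s a s') {n : ℕ}
    (H : History S A h n) : ∀ s a, IsProbabilityMeasure (dirichlet fun s' =>
      θ.α s a s' + ∑ k, ∑ j, (transitions ((H k).1 j) s a s' : ℝ)) := fun s a =>
  isProbabilityMeasure_dirichlet fun s' => add_pos_of_pos_of_nonneg (hα s a s')
    (Finset.sum_nonneg fun _ _ => Finset.sum_nonneg fun _ _ => Nat.cast_nonneg _)

lemma isMarkovKernel_sampleKernel (hα : ∀ s a s', 0 < θ.α s a s') (n : ℕ) :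
    IsMarkovKernel (sampleKernel (h := h) θ n) := by
  refine ⟨fun H => ?_⟩
  have := isProbabilityMeasure_posterior_dirichlet hα H
  change IsProbabilityMeasure (Measure.pi fun _ => (dynPosterior θ H).prod (rewardPosterior θ H))
  unfold dynPosterior rewardPosterior
  infer_instance

lemma isProbabilityMeasure_dynPosterior (hα : ∀ s a s', 0 < θ.α s a s') {n : ℕ}
    (H : History S A h n) : IsProbabilityMeasure (dynPosterior θ H) := by
  have := isProbabilityMeasure_posterior_dirichlet hα H
  unfold dynPosterior
  infer_instance

lemma measurePreserving_eval_dynPosterior (hα : ∀ s a s', 0 < θ.α s a s') {n : ℕ}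
    (H : History S A h n) (s : S) (a : A) :
    MeasurePreserving (fun p : S → A → S → ℝ => p s a) (dynPosterior θ H) (dirichlet fun s' =>
      θ.α s a s' + ∑ k, ∑ j, (transitions ((H k).1 j) s a s' : ℝ)) := by
  have := isProbabilityMeasure_posterior_dirichlet hα H
  exact (measurePreserving_eval (fun a => dirichlet fun s' =>
      θ.α s a s' + ∑ k, ∑ j, (transitions ((H k).1 j) s a s' : ℝ)) a).comp
    (measurePreserving_eval (fun s => Measure.pi fun a => dirichlet fun s' =>
      θ.α s a s' + ∑ k, ∑ j, (transitions ((H k).1 j) s a s' : ℝ)) s)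

lemma measurePreserving_sampleKernel (hα : ∀ s a s', 0 < θ.α s a s') {n : ℕ}
    (H : History S A h n) (j : Fin 2) :
    MeasurePreserving (fun x : Samples S A => x j) (sampleKernel θ n H)
      ((dynPosterior θ H).prod (rewardPosterior θ H)) := by
  have := isProbabilityMeasure_dynPosterior hα H
  have : IsProbabilityMeasure (rewardPosterior θ H) := by unfold rewardPosterior; infer_instance
  exact measurePreserving_eval (fun _ : Fin 2 => (dynPosterior θ H).prod (rewardPosterior θ H)) j

/-- Dynamics that are closer than `ε` to the true dynamics at the pairs in `U`, and arbitrary at the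
other pairs. -/
def closeDyn (M : PrefMDP S A h) (U : Finset (S × A)) (ε : ℝ) : Set (S → A → S → ℝ) :=
  {p | ∀ q ∈ U, ∀ s', |p q.1 q.2 s' - M.dyn q.1 q.2 s'| < ε}

/-- Stochastic dynamics. -/
def stochastic (S A : Type*) [Fintype S] : Set (S → A → S → ℝ) :=
  {p | (∀ s a s', 0 ≤ p s a s') ∧ ∀ s a, ∑ s', p s a s' = 1}

lemma measurableSet_closeDyn (U : Finset (S × A)) (ε : ℝ) : MeasurableSet (closeDyn M U ε) := by
  simp only [closeDyn, Set.ofPred_forall]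
  exact MeasurableSet.iInter fun q => MeasurableSet.iInter fun _ => MeasurableSet.iInter fun s' =>
    measurableSet_lt (by fun_prop) measurable_const

lemma measurableSet_stochastic : MeasurableSet (stochastic S A) := by
  have h1 : MeasurableSet {p : S → A → S → ℝ | ∀ s a s', 0 ≤ p s a s'} := by
    simp only [Set.ofPred_forall]
    exact MeasurableSet.iInter fun s => MeasurableSet.iInter fun a => MeasurableSet.iInter fun s' =>
      measurableSet_le measurable_const (by fun_prop)
  have h2 : MeasurableSet {p : S → A → S → ℝ | ∀ s a, ∑ s', p s a s' = 1} := by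
    simp only [Set.ofPred_forall]
    exact MeasurableSet.iInter fun s => MeasurableSet.iInter fun a =>
      measurableSet_eq_fun (by fun_prop) measurable_const
  exact h1.inter h2

lemma ae_dynPosterior_mem_stochastic [Nonempty S] (hα : ∀ s a s', 0 < θ.α s a s') {n : ℕ}
    (H : History S A h n) : ∀ᵐ p ∂(dynPosterior θ H), p ∈ stochastic S A := by
  have : ∀ s a, ∀ᵐ p ∂(dynPosterior θ H), (∀ s', 0 ≤ p s a s') ∧ ∑ s', p s a s' = 1 := fun s a =>
    (measurePreserving_eval_dynPosterior hα H s a).quasiMeasurePreserving.ae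
      (ae_dirichlet fun s' => add_pos_of_pos_of_nonneg (hα s a s')
        (Finset.sum_nonneg fun _ _ => Finset.sum_nonneg fun _ _ => Nat.cast_nonneg _))
  filter_upwards [ae_all_iff.2 fun s => ae_all_iff.2 (this s)] with p hp
  exact ⟨fun s a => (hp s a).1, fun s a => (hp s a).2⟩

/-- The indicator vector of the complement of `U`. -/
def outsideVec (U : Finset (S × A)) : S × A → ℝ := fun q => if q ∈ U then 0 else 1

/-- The histories after which a pair outside `U` is explored with a probability that is bounded
below: the reward estimate is at most `K β`, there are few observations outside `U`, and the
dynamics posterior has concentrated at the pairs in `U`. -/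
def explorable (M : PrefMDP S A h) (θ : Hyper S A) (U : Finset (S × A)) (K ε : ℝ) (n : ℕ) :
    Set (History S A h n) :=
  {H | ‖rewardMAP θ H‖ ≤ K * beta θ H ∧
    outsideVec U ⬝ᵥ (designMatrix θ H).mulVec (outsideVec U) ≤ K ∧
    1 / 2 ≤ (dynPosterior θ H).real (closeDyn M U ε)}

/-- After an explorable history, the samples are with a probability that is bounded below such that
every optimal policy for them leaves `U` in the true MDP with a probability that is bounded
below. -/
theorem exists_explore (M : PrefMDP S A h) {U : Finset (S × A)} {s : S} (hs : M.Reachable s)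
    {a : A} (ha : (s, a) ∉ U) (hα : ∀ s a s', 0 < θ.α s a s') (hlam : 1 ≤ θ.lam) (hR : 0 < θ.R)
    (hSr : 0 ≤ θ.Sr) (hδ0 : 0 < θ.δ) (hδ1 : θ.δ < 1) {K : ℝ} (hK : 0 ≤ K) :
    ∃ ε > 0, ∃ c > 0, ∀ (n : ℕ) (H : History S A h n), H ∈ explorable M θ U K ε n →
      ∃ G : Set (Samples S A), MeasurableSet G ∧ c ≤ (sampleKernel θ n H).real G ∧
        ∀ x ∈ G, ∀ π, IsOptimalPolicy M.init (x 0).1 (x 0).2 π →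
          c ≤ (M.rollout π).toMeasure.real (leaving U) := by
  have : Nonempty S := ⟨s⟩
  have hh : (1 : ℝ) ≤ h := by
    obtain ⟨_, _, t, _⟩ := hs
    exact_mod_cast (Nat.one_le_iff_ne_zero.2 fun h0 => by subst h0; exact t.elim0)
  obtain ⟨π', hπ'⟩ := hs.exists_stay_lt_one ha
  set η := 1 - stay M U M.dyn π' with hη
  have hη0 : 0 < η := by rw [hη]; linarith
  have hκ : 0 < η / (8 * h) := by positivity
  obtain ⟨ε, hε, hstay⟩ := exists_abs_stay_sub_lt M U hκ
  -- the shift `t` is so large that errors of size `(K + 1) β` in the rewards are negligible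
  set t := 8 * h * (K + 1) / η with ht
  have ht0 : 0 < t := by positivity
  obtain ⟨c, hc0, hc⟩ := exists_le_rewardPosterior (h := h) hlam (outsideVec U) (t := t) hK
  refine ⟨ε, hε, min (c / 2) (η / (2 * h)), lt_min (by positivity) (by positivity),
    fun n H hH => ?_⟩
  obtain ⟨hH1, hH2, hH3⟩ := hH
  have hβ : 0 < beta θ H := (betaLower_pos hR hδ0 hδ1).trans_le
    (betaLower_le_beta (zero_lt_one.trans_le hlam) hR hSr hδ0 H)
  have hP := isProbabilityMeasure_dynPosterior hα H
  have hP' : IsProbabilityMeasure (rewardPosterior θ H) := by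
    unfold rewardPosterior; infer_instance
  let G1 := closeDyn M U ε ∩ stochastic S A
  let G2 := Metric.closedBall (rewardMAP θ H + WithLp.toLp 2 ((t * beta θ H) • outsideVec U))
    (beta θ H)
  have hG1 : MeasurableSet G1 := (measurableSet_closeDyn U ε).inter measurableSet_stochastic
  have hG2 : MeasurableSet G2 := Metric.isClosed_closedBall.measurableSet
  refine ⟨(fun x : Samples S A => x 0) ⁻¹' (G1 ×ˢ G2), (hG1.prod hG2).preimage
    (measurable_pi_apply 0), ?_, ?_⟩
  · rw [(measurePreserving_sampleKernel hα H 0).measureReal_preimage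
      (hG1.prod hG2).nullMeasurableSet, measureReal_prod_prod]
    have e1 : (dynPosterior θ H).real G1 = (dynPosterior θ H).real (closeDyn M U ε) := by
      refine measureReal_congr ?_
      filter_upwards [ae_dynPosterior_mem_stochastic hα H] with p hp
      exact propext ⟨fun hq => hq.1, fun hq => ⟨hq, hp⟩⟩
    rw [e1]
    calc _ ≤ c / 2 := min_le_left _ _
      _ = 1 / 2 * c := by ring
      _ ≤ _ := mul_le_mul hH3 (hc n H hβ hH2) hc0.le measureReal_nonneg
  · rintro x ⟨⟨hx1, hx2⟩, hx3⟩ π hπ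
    refine (min_le_right _ _).trans ?_
    rw [rollout_real_leaving]
    have hr : ∀ q, |(x 0).2 q - t * beta θ H * (if q ∈ U then 0 else 1)| ≤
        (K + 1) * beta θ H := by
      intro q
      have e1 : (x 0).2 q - t * beta θ H * (if q ∈ U then 0 else 1) =
          ((x 0).2 - WithLp.toLp 2 ((t * beta θ H) • outsideVec U)) q := by
        simp [outsideVec]
      rw [e1, ← Real.norm_eq_abs]
      refine (PiLp.norm_apply_le _ q).trans ?_
      have e2 : (x 0).2 - WithLp.toLp 2 ((t * beta θ H) • outsideVec U) = ((x 0).2 -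
          (rewardMAP θ H + WithLp.toLp 2 ((t * beta θ H) • outsideVec U))) + rewardMAP θ H := by
        abel
      rw [e2]
      refine (norm_add_le _ _).trans ?_
      rw [Metric.mem_closedBall, dist_eq_norm] at hx3
      linarith
    have key := one_sub_stay_le_of_isOptimalPolicy (M := M) hx2.1 hx2.2 (mul_pos ht0 hβ) hr hπ π'
    have e3 : 2 * h * ((K + 1) * beta θ H) / (t * beta θ H) = η / 4 := by
      rw [ht]; field_simp; ring
    rw [e3] at key
    have s1 := abs_lt.1 (hstay _ hx1 π)
    have s2 := abs_lt.1 (hstay _ hx1 π')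
    have e4 : η / (8 * h) ≤ η / 8 := by
      refine div_le_div_of_nonneg_left hη0.le (by norm_num) (by linarith)
    have e5 : η * (5 / 8) ≤ h * (1 - stay M U (x 0).1 π) := by linarith [s2.2]
    have e6 : η * (5 / 8) / h ≤ 1 - stay M U (x 0).1 π := by
      rw [div_le_iff₀ (by linarith)]
      linarith
    have e7 : η * (5 / 8) / h = η / (2 * h) + η / (8 * h) := by field_simp; norm_num
    linarith [s1.1]

end GoodSamples

/-! ### Infinitely many visits and convergence of the posteriors -/

section Exploration

variable {S A : Type*} [Fintype S] [Fintype A] [DecidableEq S] [DecidableEq A]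
  [MeasurableSpace S] [MeasurableSpace A] [MeasurableSingletonClass S]
  [MeasurableSingletonClass A] {h : ℕ}
  {M : PrefMDP S A h} {θ : Hyper S A} {Ω : Type*} [MeasurableSpace Ω] {P : Measure Ω}
  [IsProbabilityMeasure P] {samp : ℕ → Ω → Samples S A} {pol : ℕ → Ω → Fin 2 → Policy S A h}
  {traj : ℕ → Ω → Fin 2 → Traj S A h} {label : ℕ → Ω → Bool}

/-- The probability of an event about the history and the samples, as an expectation over the
history. -/
lemma IsDPS.integral_samp (hD : IsDPS M θ P samp pol traj label)
    (hα : ∀ s a s', 0 < θ.α s a s') (n : ℕ) (G : History S A h n → Set (Samples S A))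
    (hG : ∀ H, MeasurableSet (G H)) (f : History S A h n → ℝ) :
    ∫ ω, f (hist (record traj label ω) n) *
        (G (hist (record traj label ω) n)).indicator 1 (samp n ω) ∂P =
      ∫ ω, f (hist (record traj label ω) n) *
        (sampleKernel θ n (hist (record traj label ω) n)).real
          (G (hist (record traj label ω) n)) ∂P := by
  have := isMarkovKernel_sampleKernel (h := h) hα n
  obtain ⟨C, hC⟩ := (Set.finite_range fun H : History S A h n => |f H|).bddAbove
  have hm : Measurable (Function.uncurry fun (H : History S A h n) (x : Samples S A) =>
      f H * (G H).indicator (1 : Samples S A → ℝ) x) :=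
    measurable_from_prod_countable_right fun H =>
      (measurable_const.indicator (hG H)).const_mul (f H)
  have key := integral_of_hasCondDistrib (hD.samp_law n) hm C fun H x => by
    rw [abs_mul]
    refine (mul_le_of_le_one_right (abs_nonneg _) ?_).trans (hC ⟨H, rfl⟩)
    by_cases hx : x ∈ G H <;> simp [hx]
  refine key.trans (integral_congr_ae (ae_of_all _ fun ω => ?_))
  simp only
  rw [integral_const_mul, integral_indicator_one (hG _)]
  rfl

/-- A pair outside `U` is visited in the next iteration with a probability that is bounded below,
conditionally on an explorable history. -/
lemma IsDPS.mul_measureReal_le (hD : IsDPS M θ P samp pol traj label)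
    (hα : ∀ s a s', 0 < θ.α s a s') {U : Finset (S × A)} {c : ℝ} (hc : 0 < c) (n : ℕ)
    (D : Set (History S A h n))
    (hDc : ∀ H ∈ D, ∃ G : Set (Samples S A), MeasurableSet G ∧ c ≤ (sampleKernel θ n H).real G ∧
        ∀ x ∈ G, ∀ π, IsOptimalPolicy M.init (x 0).1 (x 0).2 π →
          c ≤ (M.rollout π).toMeasure.real (leaving U)) :
    c * c * P.real {ω | hist (record traj label ω) n ∈ D} ≤
      P.real {ω | hist (record traj label ω) n ∈ D ∧ traj n ω 0 ∈ leaving U} := by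
  classical
  have hz := hD.aemeasurable_record
  have hint : ∀ f : History S A h n → ℝ,
      Integrable (fun ω => f (hist (record traj label ω) n)) P :=
    fun f => integrable_of_finite_range (aemeasurable_hist hz n) f
  choose! G hGm hGc hGr using hDc
  let G' : History S A h n → Set (Samples S A) := fun H => if H ∈ D then G H else ∅
  have hG' : ∀ H, MeasurableSet (G' H) := fun H => by
    by_cases hH : H ∈ D
    · simpa [G', hH] using hGm H hH
    · simp [G', hH]
  have hproj : ∀ {Y : Type _} [Finite Y] [MeasurableSpace Y] [MeasurableSingletonClass Y]
      {Z : Ω → Y} (_ : AEMeasurable Z P) (B : Set Y),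
      P.real {ω | Z ω ∈ B} = ∫ ω, B.indicator 1 (Z ω) ∂P := by
    intro Y _ _ _ Z hZ B
    rw [← integral_map hZ (f := B.indicator (1 : Y → ℝ))
      (measurable_of_countable _).aestronglyMeasurable,
      integral_indicator_one B.toFinite.measurableSet,
      map_measureReal_apply_of_aemeasurable hZ B.toFinite.measurableSet]
    rfl
  have h1 : c * c * P.real {ω | hist (record traj label ω) n ∈ D} ≤
      ∫ ω, c * (sampleKernel θ n (hist (record traj label ω) n)).real
          (G' (hist (record traj label ω) n)) ∂P := by
    rw [hproj (aemeasurable_hist hz n), ← integral_const_mul]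
    refine integral_mono (hint fun H => c * c * D.indicator 1 H)
      (hint fun H => c * (sampleKernel θ n H).real (G' H)) fun ω => ?_
    simp only
    by_cases hH : hist (record traj label ω) n ∈ D
    · simp only [hH, Set.indicator_of_mem, G', if_true, Pi.one_apply, mul_one]
      exact mul_le_mul_of_nonneg_left (hGc _ hH) hc.le
    · simp [hH, G']
  rw [← hD.integral_samp hα n G' hG' fun _ => c] at h1
  have h2 : ∫ ω, c * (G' (hist (record traj label ω) n)).indicator 1 (samp n ω) ∂P ≤
      ∫ ω, D.indicator 1 (hist (record traj label ω) n) *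
        (M.rollout (pol n ω 0)).toMeasure.real (leaving U) ∂P := by
    have hpm : AEMeasurable (fun ω => pol n ω) P := (hD.traj_law n).aemeasurable_fst.snd.snd
    refine integral_mono_ae ?_ ?_ ?_
    · refine Integrable.of_bound (C := c) ?_ (ae_of_all _ fun ω => ?_)
      · have hm : Measurable (Function.uncurry fun (H : History S A h n) (x : Samples S A) =>
            c * (G' H).indicator (1 : Samples S A → ℝ) x) :=
          measurable_from_prod_countable_right fun H =>
            (measurable_const.indicator (hG' H)).const_mul c
        exact (hm.comp_aemeasurable ((aemeasurable_hist hz n).prodMk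
          (hD.samp_law n).aemeasurable_snd)).aestronglyMeasurable
      · rw [Real.norm_eq_abs, abs_mul, abs_of_pos hc]
        refine mul_le_of_le_one_right hc.le ?_
        by_cases hx : samp n ω ∈ G' (hist (record traj label ω) n) <;> simp [hx]
    · exact integrable_of_finite_range (Z := fun ω => (hist (record traj label ω) n, pol n ω))
        ((aemeasurable_hist hz n).prodMk hpm)
        fun p : History S A h n × (Fin 2 → Policy S A h) => D.indicator 1 p.1 *
          (M.rollout (p.2 0)).toMeasure.real (leaving U)
    · filter_upwards [hD.pol_opt n] with ω hω
      by_cases hH : hist (record traj label ω) n ∈ D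
      · by_cases hx : samp n ω ∈ G (hist (record traj label ω) n)
        · simpa [G', hH, hx] using hGr _ hH _ hx _ (hω 0)
        · simp [G', hH, hx]
      · simp [G', hH]
  have h3 := hD.integral_traj n fun H τ => D.indicator 1 H * (leaving U).indicator 1 (τ 0)
  have h4 : P.real {ω | hist (record traj label ω) n ∈ D ∧ traj n ω 0 ∈ leaving U} =
      ∫ ω, D.indicator 1 (hist (record traj label ω) n) *
        (leaving U).indicator 1 (traj n ω 0) ∂P := by
    have := hproj ((aemeasurable_hist hz n).prodMk
      ((measurable_pi_apply 0).comp_aemeasurable (hD.traj_law n).aemeasurable_snd))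
      (D ×ˢ leaving U)
    refine this.trans (integral_congr_ae (ae_of_all _ fun ω => ?_))
    by_cases hx : hist (record traj label ω) n ∈ D <;>
      by_cases hy : traj n ω 0 ∈ leaving U <;> simp [hx, hy]
  rw [h4, h3]
  refine (h1.trans h2).trans_eq (integral_congr_ae (ae_of_all _ fun ω => ?_))
  simp only
  rw [integral_const_mul, integral_comp_eval (μ := fun j => (M.rollout (pol n ω j)).toMeasure)
    (i := 0) (f := (leaving U).indicator (1 : Traj S A h → ℝ))
    (measurable_of_countable _).aestronglyMeasurable,
    integral_indicator_one (Set.toFinite _).measurableSet]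

lemma visits_eq_zero_of_notMem_leaving {U : Finset (S × A)} {τ : Traj S A h}
    (hτ : τ ∉ leaving U) {q : S × A} (hq : q ∉ U) : visits τ q = 0 := by
  rw [visits_apply]
  refine Finset.sum_eq_zero fun t _ => if_neg ?_
  rintro rfl
  exact hτ ⟨t, hq⟩

lemma exists_visits_of_mem_leaving {U : Finset (S × A)} {τ : Traj S A h}
    (hτ : τ ∈ leaving U) : ∃ q ∉ U, 1 ≤ visits τ q := by
  obtain ⟨t, ht⟩ := hτ
  refine ⟨_, ht, ?_⟩
  rw [visits_apply]
  refine le_trans (by simp) (Finset.single_le_sum (f := fun u : Fin h =>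
    if (τ.1 u.castSucc, τ.2 u) = (τ.1 t.castSucc, τ.2 t) then (1 : ℝ) else 0)
    (fun u _ => by split_ifs <;> norm_num) (Finset.mem_univ t))

/-- The visit counts of a pair that is visited infinitely often tend to infinity. -/
lemma tendsto_visitCount {z : ℕ → (Fin 2 → Traj S A h) × Bool} {s : S} {a : A}
    (hfreq : ∃ᶠ k in atTop, 1 ≤ ∑ j, visits ((z k).1 j) (s, a)) :
    Tendsto (fun n => visitCount (hist z n) s a) atTop atTop := by
  have hstep : ∀ n, 0 ≤ ∑ j, visits ((z n).1 j) (s, a) := fun n =>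
    Finset.sum_nonneg fun _ _ => visits_nonneg _ _
  have hmono : Monotone fun n => visitCount (hist z n) s a := monotone_nat_of_le_succ fun n => by
    rw [visitCount_hist_succ]
    exact le_add_of_nonneg_right (hstep n)
  have hnat : ∀ m : ℕ, ∃ n, (m : ℝ) ≤ visitCount (hist z n) s a := by
    intro m
    induction m with
    | zero => exact ⟨0, by simpa using visitCount_nonneg _ _ _⟩
    | succ m ih =>
      obtain ⟨n, hn⟩ := ih
      obtain ⟨k, hk, hk1⟩ := (frequently_atTop.1 hfreq) n
      refine ⟨k + 1, ?_⟩
      rw [visitCount_hist_succ]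
      push_cast
      linarith [hmono hk]
  refine tendsto_atTop_atTop_of_monotone hmono fun b => ?_
  obtain ⟨m, hm⟩ := exists_nat_ge b
  obtain ⟨n, hn⟩ := hnat m
  exact ⟨n, hm.trans hn⟩

/-- On a sequence of histories along which the transition frequencies at `(s, a)` converge and
`(s, a)` is visited infinitely often, the posterior of the dynamics at `(s, a)` concentrates. -/
lemma tendsto_dynPosterior_ge (hα : ∀ s a s', 0 < θ.α s a s')
    {z : ℕ → (Fin 2 → Traj S A h) × Bool} {s : S} {a : A}
    (hvis : Tendsto (fun n => visitCount (hist z n) s a) atTop atTop)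
    (htrans : ∀ s', Tendsto (fun n => transCount (hist z n) s a s' /
        (1 + visitCount (hist z n) s a)) atTop (𝓝 (M.dyn s a s')))
    {ε : ℝ} (hε : 0 < ε) (s' : S) :
    Tendsto (fun n => (dynPosterior θ (hist z n)).real {p | ε ≤ |p s a s' - M.dyn s a s'|})
      atTop (𝓝 0) := by
  have hvis' : Tendsto (fun n => 1 + visitCount (hist z n) s a) atTop atTop :=
    tendsto_atTop_add_const_left _ _ hvis
  have key := tendsto_dirichlet_real_ge
    (α := fun n s' => θ.α s a s' + transCount (hist z n) s a s')
    (fun n s' => add_pos_of_pos_of_nonneg (hα s a s')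
      (Finset.sum_nonneg fun _ _ => Finset.sum_nonneg fun _ _ => Nat.cast_nonneg _))
    (N := fun n => 1 + visitCount (hist z n) s a)
    (fun n => by have := visitCount_nonneg (hist z n) s a; positivity) hvis' (M.sum_dyn s a)
    (fun s' => by
      have h1 := (hvis'.const_div_atTop (θ.α s a s')).add (htrans s')
      rw [zero_add] at h1
      exact h1.congr fun n => (add_div _ _ _).symm) hε s'
  refine key.congr fun n => ?_
  exact ((measurePreserving_eval_dynPosterior hα (hist z n) s a).measureReal_preimage
    (measurableSet_le (f := fun _ : S → ℝ => ε) (g := fun x : S → ℝ => |x s' - M.dyn s a s'|)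
      measurable_const (by fun_prop)).nullMeasurableSet).symm

lemma eventually_le_dynPosterior_closeDyn (hα : ∀ s a s', 0 < θ.α s a s')
    {z : ℕ → (Fin 2 → Traj S A h) × Bool} {U : Finset (S × A)}
    (hU : ∀ q ∈ U, ∀ s' : S, ∀ ε > 0, Tendsto (fun n =>
      (dynPosterior θ (hist z n)).real {p | ε ≤ |p q.1 q.2 s' - M.dyn q.1 q.2 s'|}) atTop (𝓝 0))
    {ε : ℝ} (hε : 0 < ε) :
    ∀ᶠ n in atTop, 1 / 2 ≤ (dynPosterior θ (hist z n)).real (closeDyn M U ε) := by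
  have hsum : Tendsto (fun n => ∑ q ∈ U, ∑ s', (dynPosterior θ (hist z n)).real
      {p | ε ≤ |p q.1 q.2 s' - M.dyn q.1 q.2 s'|}) atTop (𝓝 0) := by
    have := tendsto_finsetSum U fun q hq => tendsto_finsetSum Finset.univ
      fun s' (_ : s' ∈ Finset.univ) => hU q hq s' ε hε
    simpa using this
  filter_upwards [hsum.eventually_le_const (show (0 : ℝ) < 1 / 2 by norm_num)] with n hn
  have hP := isProbabilityMeasure_dynPosterior hα (hist z n)
  have hcompl : (dynPosterior θ (hist z n)).real (closeDyn M U ε)ᶜ ≤ 1 / 2 := by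
    refine le_trans ?_ hn
    have hsub : (closeDyn M U ε)ᶜ ⊆ ⋃ q ∈ U, ⋃ s' ∈ Finset.univ,
        {p | ε ≤ |p q.1 q.2 s' - M.dyn q.1 q.2 s'|} := by
      intro p hp
      simp only [closeDyn, Set.mem_compl_iff, Set.mem_ofPred_eq, not_forall, not_lt] at hp
      obtain ⟨q, hq, s', hs'⟩ := hp
      simp only [Set.mem_iUnion]
      exact ⟨q, hq, s', Finset.mem_univ _, hs'⟩
    refine (measureReal_mono hsub (measure_ne_top _ _)).trans ?_
    exact (measureReal_biUnion_finset_le _ _).trans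
      (Finset.sum_le_sum fun q _ => measureReal_biUnion_finset_le _ _)
  rw [probReal_compl_eq_one_sub (measurableSet_closeDyn U ε)] at hcompl
  linarith

/-- The observations outside `U` stay bounded if `U` is eventually not left any more. -/
lemma exists_outsideVec_designMatrix_le {z : ℕ → (Fin 2 → Traj S A h) × Bool}
    {U : Finset (S × A)} (hev : ∀ᶠ k in atTop, ∀ j, (z k).1 j ∉ leaving U) :
    ∃ K : ℕ, ∀ n,
      outsideVec U ⬝ᵥ (designMatrix θ (hist z n)).mulVec (outsideVec U) ≤ K := by
  obtain ⟨m, hm⟩ := eventually_atTop.1 hev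
  set f : ℕ → ℝ := fun k => (feature (z k).1 ⬝ᵥ outsideVec U) ^ 2 with hf
  have hf0 : ∀ k, m ≤ k → f k = 0 := by
    intro k hk
    have : feature (z k).1 ⬝ᵥ outsideVec U = 0 := by
      refine Finset.sum_eq_zero fun q _ => ?_
      by_cases hq : q ∈ U
      · simp [outsideVec, hq]
      · simp [feature, visits_eq_zero_of_notMem_leaving (hm k hk _) hq]
    simp [hf, this]
  obtain ⟨K, hK⟩ := exists_nat_ge (θ.lam * (outsideVec U ⬝ᵥ outsideVec U) +
    ∑ k ∈ Finset.range m, f k)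
  refine ⟨K, fun n => le_trans ?_ hK⟩
  have e1 : ∑ k : Fin n, ((fun q => obs (hist z n) k q) ⬝ᵥ outsideVec U) ^ 2 =
      ∑ k ∈ Finset.range n, f k := (Finset.sum_range f).symm
  rw [dotProduct_designMatrix_mulVec, e1]
  refine add_le_add le_rfl ?_
  rw [← Finset.sum_filter_add_sum_filter_not (Finset.range n) (fun k => k < m),
    Finset.sum_eq_zero (s := (Finset.range n).filter fun k => ¬ k < m)
      (fun k hk => hf0 k (not_lt.1 (Finset.mem_filter.1 hk).2)), add_zero]
  exact Finset.sum_le_sum_of_subset_of_nonneg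
    (fun k hk => Finset.mem_range.2 (Finset.mem_filter.1 hk).2) fun k _ _ => sq_nonneg _

/-- Almost surely, every pair with a reachable state is visited infinitely often. -/
theorem IsDPS.ae_tendsto_visitCount (hD : IsDPS M θ P samp pol traj label)
    {rbar : EuclideanSpace ℝ (S × A)} (hlink : M.HasLinearLink rbar)
    (hα : ∀ s a s', 0 < θ.α s a s') (hlam : 1 ≤ θ.lam) (hR : 0 < θ.R)
    (hSr : 0 ≤ θ.Sr) (hδ0 : 0 < θ.δ) (hδ1 : θ.δ < 1) :
    ∀ᵐ ω ∂P, ∀ s a, M.Reachable s →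
      Tendsto (fun n => visitCount (hist (record traj label ω) n) s a) atTop atTop := by
  classical
  have hz := hD.aemeasurable_record
  have hnot : ∀ᵐ ω ∂P, ∀ (U : Finset (S × A)) (K : ℕ) (q : S × A), M.Reachable q.1 → q ∉ U →
      ∃ ε > 0, ¬ ∀ᶠ n in atTop, hist (record traj label ω) n ∈ explorable M θ U K ε n ∧
        traj n ω 0 ∉ leaving U := by
    simp only [ae_all_iff]
    intro U K q hq hqU
    obtain ⟨ε, hε, c, hc, hgood⟩ := exists_explore M hq hqU hα hlam hR hSr hδ0 hδ1
      (K := K) (Nat.cast_nonneg K)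
    filter_upwards [ae_not_eventually_of_cond_lower_bound hz (explorable M θ U K ε)
      {x | x.1 0 ∈ leaving U} (mul_pos hc hc) fun n D hDs =>
        hD.mul_measureReal_le hα hc n D fun H hH => hgood n H (hDs hH)] with ω hω
    exact ⟨ε, hε, hω⟩
  filter_upwards [hnot, hD.ae_norm_rewardMAP_le hlink hlam hR hSr hδ0 hδ1,
    hD.ae_tendsto_transCount_div] with ω h1 ⟨K1, hK1⟩ h3
  set z := record traj label ω with hzdef
  -- the pairs that are visited infinitely often
  let U : Finset (S × A) :=
    Finset.univ.filter fun q => ∃ᶠ k in atTop, 1 ≤ ∑ j, visits ((z k).1 j) q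
  have hUiff : ∀ q, q ∈ U ↔ ∃ᶠ k in atTop, 1 ≤ ∑ j, visits ((z k).1 j) q := fun q => by
    simp only [U, Finset.mem_filter, Finset.mem_univ, true_and]
  have hUt : ∀ q ∈ U, Tendsto (fun n => visitCount (hist z n) q.1 q.2) atTop atTop := by
    rintro ⟨s, a⟩ hq
    exact tendsto_visitCount ((hUiff _).1 hq)
  clear_value U
  intro s a hs
  by_contra hsa
  have hqU : (s, a) ∉ U := fun hq => hsa (hUt (s, a) hq)
  have hev : ∀ᶠ k in atTop, ∀ j, (z k).1 j ∉ leaving U := by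
    have h4 : ∀ᶠ k in atTop, ∀ q, q ∉ U → ¬ 1 ≤ ∑ j, visits ((z k).1 j) q := by
      refine eventually_all.2 fun q => ?_
      by_cases hq : q ∈ U
      · simp [hq]
      · have : ¬ ∃ᶠ k in atTop, 1 ≤ ∑ j, visits ((z k).1 j) q := fun hf =>
          hq ((hUiff q).2 hf)
        filter_upwards [not_frequently.1 this] with k hk _ using hk
    filter_upwards [h4] with k hk j hj
    obtain ⟨q, hq, hv⟩ := exists_visits_of_mem_leaving hj
    exact hk q hq (hv.trans (Finset.single_le_sum (f := fun j => visits ((z k).1 j) q)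
      (fun j _ => visits_nonneg _ _) (Finset.mem_univ j)))
  obtain ⟨K2, hK2⟩ := exists_outsideVec_designMatrix_le (θ := θ) hev
  obtain ⟨ε, hε, hfalse⟩ := h1 U (max K1 K2) (s, a) hs hqU
  apply hfalse
  filter_upwards [hev, eventually_le_dynPosterior_closeDyn (M := M) hα (fun q hq s' ε hε =>
    tendsto_dynPosterior_ge hα (hUt q hq) (fun s' => h3 q.1 q.2 s' (hUt q hq)) hε s') hε]
    with n hn1 hn2
  have hβ : 0 ≤ beta θ (hist z n) := (betaLower_pos hR hδ0 hδ1).le.trans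
    (betaLower_le_beta (zero_lt_one.trans_le hlam) hR hSr hδ0 _)
  refine ⟨⟨(hK1 n).trans (mul_le_mul_of_nonneg_right ?_ hβ), (hK2 n).trans ?_, hn2⟩, hn1 0⟩
  · exact_mod_cast le_max_left K1 K2
  · exact_mod_cast le_max_right K1 K2

/-- At pairs with a reachable state, the sampled dynamics converge to the true ones in
probability. -/
theorem IsDPS.tendsto_measureReal_samp (hD : IsDPS M θ P samp pol traj label)
    {rbar : EuclideanSpace ℝ (S × A)} (hlink : M.HasLinearLink rbar)
    (hα : ∀ s a s', 0 < θ.α s a s') (hlam : 1 ≤ θ.lam) (hR : 0 < θ.R)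
    (hSr : 0 ≤ θ.Sr) (hδ0 : 0 < θ.δ) (hδ1 : θ.δ < 1) (j : Fin 2) {s : S} (hs : M.Reachable s)
    (a : A) (s' : S) {ε : ℝ} (hε : 0 < ε) :
    Tendsto (fun i => P.real {ω | ε ≤ |(samp i ω j).1 s a s' - M.dyn s a s'|}) atTop (𝓝 0) := by
  have hz := hD.aemeasurable_record
  let B : Set (S → A → S → ℝ) := {p | ε ≤ |p s a s' - M.dyn s a s'|}
  have hB : MeasurableSet B := measurableSet_le measurable_const (by fun_prop)
  let B' : Set (Samples S A) := {x | (x j).1 ∈ B}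
  have hB' : MeasurableSet B' := hB.preimage (measurable_pi_apply j).fst
  have heq : ∀ i, ∫ ω, (dynPosterior θ (hist (record traj label ω) i)).real B ∂P =
      P.real {ω | ε ≤ |(samp i ω j).1 s a s' - M.dyn s a s'|} := by
    intro i
    have h1 := hD.integral_samp hα i (fun _ => B') (fun _ => hB') fun _ => 1
    simp only [one_mul] at h1
    have hsm : AEMeasurable (samp i) P := (hD.samp_law i).aemeasurable_snd
    have h2 : ∫ ω, B'.indicator (1 : Samples S A → ℝ) (samp i ω) ∂P =
        P.real {ω | ε ≤ |(samp i ω j).1 s a s' - M.dyn s a s'|} := by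
      rw [← integral_map hsm (f := B'.indicator (1 : Samples S A → ℝ))
        ((measurable_const.indicator hB').aestronglyMeasurable), integral_indicator_one hB',
        map_measureReal_apply_of_aemeasurable hsm hB']
      rfl
    rw [← h2, h1]
    refine integral_congr_ae (ae_of_all _ fun ω => ?_)
    simp only
    have hP := isProbabilityMeasure_dynPosterior hα (hist (record traj label ω) i)
    have hP' : IsProbabilityMeasure (rewardPosterior θ (hist (record traj label ω) i)) := by
      unfold rewardPosterior; infer_instance
    have h3 := (measurePreserving_sampleKernel hα (hist (record traj label ω) i) j)
    have h4 := h3.measureReal_preimage (s := B ×ˢ Set.univ)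
      (hB.prod MeasurableSet.univ).nullMeasurableSet
    rw [measureReal_prod_prod, probReal_univ, mul_one] at h4
    rw [← h4]
    congr 1
    ext x
    simp [B']
  simp only [← heq]
  rw [show (0 : ℝ) = ∫ _, (0 : ℝ) ∂P by simp]
  refine tendsto_integral_of_dominated_convergence (fun _ => 1) (fun i => ?_) (integrable_const _)
    (fun i => ae_of_all _ fun ω => ?_) ?_
  · exact (integrable_of_finite_range (aemeasurable_hist hz i)
      fun H => (dynPosterior θ H).real B).aestronglyMeasurable
  · have hP := isProbabilityMeasure_dynPosterior hα (hist (record traj label ω) i)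
    rw [Real.norm_of_nonneg measureReal_nonneg]
    exact measureReal_le_one
  · filter_upwards [hD.ae_tendsto_visitCount hlink hα hlam hR hSr hδ0 hδ1,
      hD.ae_tendsto_transCount_div] with ω h1 h2
    exact tendsto_dynPosterior_ge hα (h1 s a hs) (fun s' => h2 s a s' (h1 s a hs)) hε s'

end Exploration

/-- Coordinatewise convergence in probability implies convergence in distribution, for random
vectors with finitely many coordinates that are arranged in any way. -/
lemma tendstoInDistribution_of_coord {Ω E κ : Type*} [MeasurableSpace Ω] {P : Measure Ω}
    [IsProbabilityMeasure P] [PseudoMetricSpace E] [MeasurableSpace E] [BorelSpace E] [Finite κ]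
    {X : ℕ → Ω → E} (hX : ∀ i, AEMeasurable (X i) P) (x : E) (coord : κ → E → ℝ)
    (hcoord : ∀ ε > 0, ∀ y, (∀ k, |coord k y - coord k x| < ε) → dist y x < ε)
    (h : ∀ k, ∀ ε > 0,
      Tendsto (fun i => P.real {ω | ε ≤ |coord k (X i ω) - coord k x|}) atTop (𝓝 0)) :
    TendstoInDistribution X atTop (fun _ => x) (fun _ => P) P := by
  have := Fintype.ofFinite κ
  refine TendstoInMeasure.tendstoInDistribution ?_ hX
  refine tendstoInMeasure_of_ne_top fun ε hε hεt => ?_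
  have hε' : 0 < ε.toReal := ENNReal.toReal_pos hε.ne' hεt
  have hsum : Tendsto (fun i => ∑ k, P.real {ω | ε.toReal ≤ |coord k (X i ω) - coord k x|})
      atTop (𝓝 0) := by
    simpa using tendsto_finsetSum Finset.univ fun k (_ : k ∈ Finset.univ) => h k _ hε'
  have hreal : Tendsto (fun i => P.real {ω | ε ≤ edist (X i ω) x}) atTop (𝓝 0) := by
    refine squeeze_zero (fun _ => measureReal_nonneg) (fun i => ?_) hsum
    refine (measureReal_mono (s₂ := ⋃ k ∈ Finset.univ,
      {ω | ε.toReal ≤ |coord k (X i ω) - coord k x|}) ?_ (measure_ne_top _ _)).trans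
      (measureReal_biUnion_finset_le _ _)
    intro ω hω
    by_contra hcon
    simp only [Set.mem_iUnion, Finset.mem_univ, exists_prop, true_and, Set.mem_ofPred_eq,
      not_exists, not_le] at hcon
    have h1 := hcoord _ hε' (X i ω) hcon
    rw [Set.mem_ofPred_eq, edist_dist, ENNReal.le_ofReal_iff_toReal_le hεt dist_nonneg] at hω
    exact absurd h1 (not_lt.2 hω)
  rw [← ENNReal.tendsto_toReal_iff (fun i => measure_ne_top _ _) ENNReal.zero_ne_top]
  simpa [measureReal_def] using hreal

end DPS

end

theorem proposition1 {S A : Type*} [Fintype S] [Fintype A] [DecidableEq S] [DecidableEq A]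
    [MeasurableSpace S] [MeasurableSpace A] [MeasurableSingletonClass S]
    [MeasurableSingletonClass A] {h : ℕ}
    (M : DPS.PrefMDP S A h) (rbar : EuclideanSpace ℝ (S × A)) (hlink : M.HasLinearLink rbar)
    (θ : DPS.Hyper S A) (hα : ∀ s a s', 0 < θ.α s a s') (hlam : 1 ≤ θ.lam) (hR : 0 < θ.R)
    (hSr : ‖rbar‖ ≤ θ.Sr) (hδ0 : 0 < θ.δ) (hδ1 : θ.δ < 1)
    {Ω : Type*} [MeasurableSpace Ω] (P : Measure Ω) [IsProbabilityMeasure P]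
    (samp : ℕ → Ω → DPS.Samples S A) (pol : ℕ → Ω → Fin 2 → DPS.Policy S A h)
    (traj : ℕ → Ω → Fin 2 → DPS.Traj S A h) (label : ℕ → Ω → Bool)
    (hDPS : DPS.IsDPS M θ P samp pol traj label) :
    (∀ j : Fin 2, TendstoInDistribution
      (fun (i : ℕ) ω (q : {q : S × A // M.Reachable q.1}) => (samp i ω j).1 q.1.1 q.1.2)
      atTop (fun _ q => M.dyn q.1.1 q.1.2) (fun _ => P) P) ∧
    ((∀ s, M.Reachable s) → ∀ j : Fin 2, TendstoInDistribution
      (fun (i : ℕ) ω => (samp i ω j).1) atTop (fun _ => M.dyn) (fun _ => P) P) := by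
  have hSr0 : 0 ≤ θ.Sr := (norm_nonneg _).trans hSr
  have hm : ∀ (j : Fin 2) i, AEMeasurable (fun ω => (samp i ω j).1) P := fun j i =>
    ((measurable_pi_apply (X := fun _ : Fin 2 => (S → A → S → ℝ) × EuclideanSpace ℝ (S × A))
      j).fst).comp_aemeasurable (hDPS.samp_law i).aemeasurable_snd
  refine ⟨fun j => ?_, fun hreach j => ?_⟩
  · classical
    refine DPS.tendstoInDistribution_of_coord (κ := {q : S × A // M.Reachable q.1} × S)
      (fun i => ?_) _ (fun k p => p k.1 k.2) (fun ε hε y hy => ?_) fun k ε hε => ?_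
    · have hr : Measurable fun (p : S → A → S → ℝ) (q : {q : S × A // M.Reachable q.1}) =>
          p q.1.1 q.1.2 := by fun_prop
      exact hr.comp_aemeasurable (hm j i)
    · exact (dist_pi_lt_iff hε).2 fun q => (dist_pi_lt_iff hε).2 fun s' => hy (q, s')
    · exact hDPS.tendsto_measureReal_samp hlink hα hlam hR hSr0 hδ0 hδ1 j k.1.2 _ _ hε
  · refine DPS.tendstoInDistribution_of_coord (κ := S × A × S) (hm j) _
      (fun k p => p k.1 k.2.1 k.2.2) (fun ε hε y hy => ?_) fun k ε hε => ?_
    · exact (dist_pi_lt_iff hε).2 fun s => (dist_pi_lt_iff hε).2 fun a =>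
        (dist_pi_lt_iff hε).2 fun s' => hy (s, a, s')
    · exact hDPS.tendsto_measureReal_samp hlink hα hlam hR hSr0 hδ0 hδ1 j (hreach _) _ _ hε
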